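/- **Model.** Let $H_0$ be a finite hypergraph (hyperedges are non-empty multisets of vertices, and may be repeated), $m\in\mathbb N$, $\gamma\ge 0$ with $\sum_{v}(\deg_{H_0}(v)+\gamma)>0$ (for instance a single vertex with one hyperedge of cardinality $1$), and let $p_v,p_{ve},p_e^{(1)},\dots,p_e^{(r)}\ge 0$ with sum in $(0,1]$. Let $Y_t$ and $X_t^{(i)}$ ($t\ge 0$, $1\le i\le r$) be independent random variables with values in $\{1,2,\dots\}$. Choosing a vertex of $H_t=(V_t,E_t)$ in proportion to degrees means choosing $u\in V_t$ with probability $(\deg_t(u)+\gamma)/\sum_{v\in V_t}(\deg_t(v)+\gamma)$. For $t\ge 0$, $H_{t+1}$ arises from $H_t$ by exactly one of the following events: with probability $p_v$, add an isolated vertex; with probability $p_{ve}$, add a vertex $v$, draw $y$ from $Y_t$, and $m$ times add a hyperedge consisting of $v$ and $y-1$ vertices chosen from $V_t$ independently (with repetition) in proportion to degrees; with probability $p_e^{(i)}$, draw $x$ from $X_t^{(i)}$, and $m$ times add a hyperedge consisting of $x$ vertices chosen from $V_t$ independently in proportion to degrees; with the remaining probability, do nothing. Let $N_{k,t}$ be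 the number of vertices of degree $k$ in $H_t$, and $D_t$ the sum of the degrees in $H_t$. **Theorem.** Suppose that $\mathbb E[Y_t]=\mu_0$ and $\mathbb E[X_t^{(i)}]=\mu_i$ for all $t$ and $i$, and that $Y_t<t^{1/4}$ and $X_t^{(i)}<t^{1/4}$ almost surely for all sufficiently large $t$. Put $\bar V=p_v+p_{ve}$ and $\bar D=m\bigl(p_{ve}\mu_0+\sum_{i=1}^r p_e^{(i)}\mu_i\bigr)$, and suppose that $\bar D\ne m\,p_{ve}$ and $\gamma\bar V+m\,p_{ve}\ne 0$. Then the degree distribution follows a power law with exponent $$\beta=2+\frac{\gamma\bar V+m\,p_{ve}}{\bar D-m\,p_{ve}}\ \ge 1 ,$$ that is, for every $k\ge 0$ the limit $L_k=\lim_{t\to\infty}\mathbb E\bigl[N_{k,t}/|V_t|\bigr]$ exists, and there is a constant $\tilde c>0$ with $L_k/(\tilde c\,k^{-\beta})\to 1$ as $k\to\infty$. In particular: (Barabási–Albert) if $p_v=0$, $p_{ve}=1$, $\gamma=0$, $\mu_0=2$, then $\beta=3$; (Chung–Lu) if $p_v=0$, $p_{ve}+\sum_i p_e^{(i)}=1$,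 $m=1$, $\gamma=0$ and $\mu_0=\mu_1=\dots=\mu_r=2$, then $\beta=2+p_{ve}/(2-p_{ve})$; (Avin et al.) if $p_v=0$, $p_{ve}+\sum_i p_e^{(i)}=1$, $m=1$, $\gamma=0$ and $\mu_0=\mu_1=\dots=\mu_r$, then $D=\lim_{t\to\infty}\dfrac{\mathbb E[D_{t-1}]/t}{\mu_0-p_{ve}}$ exists and $\beta=1+D$. -/

import Mathlib

open Filter Topology
open scoped NNReal ENNReal

noncomputable section

namespace PrefAttach

/-- A finite hypergraph on the non-empty vertex set `{0, …, order - 1}`. Hyperedges are multisets of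
vertices (a vertex may appear several times in a hyperedge), and hyperedges may be repeated. -/
structure MultiHypergraph where
  order : ℕ
  order_pos : 0 < order
  edges : Multiset (Multiset ℕ)
  lt_order : ∀ e ∈ edges, ∀ v ∈ e, v < order

namespace MultiHypergraph

instance (H : MultiHypergraph) : Nonempty (Fin H.order) := ⟨⟨0, H.order_pos⟩⟩

/-- The discrete σ-algebra: every set of hypergraphs is an event. -/
instance : MeasurableSpace MultiHypergraph := ⊤

/-- The degree of `v`: the number of times it appears in all hyperedges. -/
def degree (H : MultiHypergraph) (v : ℕ) : ℕ := (H.edges.map fun e => e.count v).sum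

/-- The sum of the degrees of all vertices. -/
def totalDegree (H : MultiHypergraph) : ℕ := ∑ v ∈ Finset.range H.order, H.degree v

/-- The number of vertices of degree `k`. -/
def numDegree (H : MultiHypergraph) (k : ℕ) : ℕ :=
  ((Finset.range H.order).filter fun v => H.degree v = k).card

/-- The normalising weight `∑ v, (deg v + γ)`. -/
def weight (H : MultiHypergraph) (γ : ℝ≥0) : ℝ≥0 :=
  ∑ v ∈ Finset.range H.order, ((H.degree v : ℝ≥0) + γ)

/-- Choosing one vertex in proportion to degrees: `u` is chosen with probability
`(deg u + γ) / ∑ v, (deg v + γ)`. (If all the weights vanish, which never happens in the model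
below, the choice is uniform.) -/
def chooseVertex (H : MultiHypergraph) (γ : ℝ≥0) : PMF (Fin H.order) :=
  if h : H.weight γ = 0 then PMF.uniformOfFintype (Fin H.order)
  else PMF.ofFintype (fun u => ((((H.degree u : ℝ≥0) + γ) / H.weight γ : ℝ≥0) : ℝ≥0∞)) (by
    rw [← ENNReal.ofNNReal_finsetSum, ← Finset.sum_div,
      Fin.sum_univ_eq_sum_range (fun v => (H.degree v : ℝ≥0) + γ), ← weight, div_self h,
      ENNReal.coe_one])

/-- Add the members of `es` as new hyperedges on the existing vertices. -/
def addEdges (H : MultiHypergraph) (es : Multiset (Multiset (Fin H.order))) : MultiHypergraph where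
  order := H.order
  order_pos := H.order_pos
  edges := H.edges + es.map fun e => e.map Fin.val
  lt_order := by
    intro e he v hv
    rcases Multiset.mem_add.1 he with h | h
    · exact H.lt_order e h v hv
    · obtain ⟨f, -, rfl⟩ := Multiset.mem_map.1 h
      obtain ⟨w, -, rfl⟩ := Multiset.mem_map.1 hv
      exact w.isLt

/-- Add one new vertex (labelled `H.order`), and for each `e` in `es` a new hyperedge consisting of
the new vertex and the vertices in `e`. -/
def addVertex (H : MultiHypergraph) (es : Multiset (Multiset (Fin H.order))) : MultiHypergraph where
  order := H.order + 1
  order_pos := Nat.succ_pos _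
  edges := H.edges + es.map fun e => H.order ::ₘ e.map Fin.val
  lt_order := by
    intro e he v hv
    rcases Multiset.mem_add.1 he with h | h
    · exact Nat.lt_succ_of_lt (H.lt_order e h v hv)
    · obtain ⟨f, -, rfl⟩ := Multiset.mem_map.1 h
      rcases Multiset.mem_cons.1 hv with rfl | hv
      · exact Nat.lt_succ_self _
      · obtain ⟨w, -, rfl⟩ := Multiset.mem_map.1 hv
        exact Nat.lt_succ_of_lt w.isLt

end MultiHypergraph

/-- The multiset of the values of `n` independent draws from `p`. -/
def draws {α : Type} (p : PMF α) : ℕ → PMF (Multiset α)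
  | 0 => PMF.pure 0
  | n + 1 => p.bind fun a => (draws p n).map fun s => a ::ₘ s

/-- The kinds of events that may occur in one time step. -/
inductive Event (r : ℕ) where
  | vertex : Event r
  | vertexEdges : Event r
  | edges (i : Fin r) : Event r
  | nothing : Event r

/-- The parameters `(H₀, p, Y, X, m, γ)` of the preferential attachment hypergraph. The independent
random variables `Y t` and `X i t` enter through their distributions. -/
structure Model (r : ℕ) where
  /-- the initial hypergraph -/
  H₀ : MultiHypergraph
  H₀_nonempty : ∀ e ∈ H₀.edges, e ≠ 0
  /-- the probability of adding an isolated vertex -/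
  pv : ℝ≥0
  /-- the probability of adding a vertex together with hyperedges -/
  pve : ℝ≥0
  /-- the probabilities of adding hyperedges only, with cardinalities distributed as `X i t` -/
  pe : Fin r → ℝ≥0
  p_pos : 0 < pv + pve + ∑ i, pe i
  p_le_one : pv + pve + ∑ i, pe i ≤ 1
  Y : ℕ → PMF ℕ
  Y_pos : ∀ t, ∀ y ∈ (Y t).support, 1 ≤ y
  X : Fin r → ℕ → PMF ℕ
  X_pos : ∀ i t, ∀ x ∈ (X i t).support, 1 ≤ x
  /-- the number of hyperedges added at once -/
  m : ℕ
  γ : ℝ≥0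
  /-- choosing a vertex of `H₀` in proportion to degrees makes sense -/
  weight_pos : 0 < H₀.weight γ

namespace Model

variable {r : ℕ} (P : Model r)

/-- The random kind of event of one time step; the remaining probability is that of doing
nothing. -/
def eventLaw : PMF (Event r) :=
  (PMF.ofFintype
    (fun o : Fin r ⊕ Fin 3 => ((Sum.elim P.pe
      ![P.pv, P.pve, 1 - (P.pv + P.pve + ∑ i, P.pe i)] o : ℝ≥0) : ℝ≥0∞)) (by
      rw [← ENNReal.ofNNReal_finsetSum, Fintype.sum_sum_type, Fin.sum_univ_three]
      simp only [Sum.elim_inl, Sum.elim_inr, Matrix.cons_val]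
      rw [show ∀ a b c d : ℝ≥0, a + (b + c + d) = b + c + a + d by intros; ring,
        add_tsub_cancel_of_le P.p_le_one, ENNReal.coe_one])).map
    (Sum.elim Event.edges ![Event.vertex, Event.vertexEdges, Event.nothing])

/-- The distribution of `H_{t+1}` given `H_t = H`. -/
def step (t : ℕ) (H : MultiHypergraph) : PMF MultiHypergraph :=
  P.eventLaw.bind fun
    | .vertex => PMF.pure (H.addVertex 0)
    | .vertexEdges => (P.Y t).bind fun y =>
        (draws (draws (H.chooseVertex P.γ) (y - 1)) P.m).map H.addVertex
    | .edges i => (P.X i t).bind fun x =>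
        (draws (draws (H.chooseVertex P.γ) x) P.m).map H.addEdges
    | .nothing => PMF.pure H

/-- The distribution of the random hypergraph `H_t`. -/
def law : ℕ → PMF MultiHypergraph
  | 0 => PMF.pure P.H₀
  | t + 1 => (law t).bind (P.step t)

/-- The expectation of `f (H_t)`. -/
def expect (t : ℕ) (f : MultiHypergraph → ℝ) : ℝ := ∫ H, f H ∂(P.law t).toMeasure

/-- The degree distribution follows a power law with exponent `β`: the limits
`L k = lim_t E[N_{k,t} / |V_t|]` exist, and `L k ∼ c * k ^ (-β)` as `k → ∞`, for some `c > 0`. -/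
def FollowsPowerLaw (β : ℝ) : Prop :=
  1 ≤ β ∧ ∃ L : ℕ → ℝ,
    (∀ k, Tendsto (fun t => P.expect t fun H => (H.numDegree k : ℝ) / H.order)
      atTop (𝓝 (L k))) ∧
    ∃ c : ℝ, 0 < c ∧ Tendsto (fun k : ℕ => L k / (c * (k : ℝ) ^ (-β))) atTop (𝓝 1)

/-- The expected number of vertices added in one time step. -/
def Vbar : ℝ := P.pv + P.pve

/-- The expected increase of the sum of degrees in one time step, when the `Y t` have mean `μ₀` and
the `X i t` have mean `μ i`. -/
def Dbar (μ₀ : ℝ) (μ : Fin r → ℝ) : ℝ := P.m * (P.pve * μ₀ + ∑ i, P.pe i * μ i)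

/-- The exponent `2 + (γ V̄ + m p_ve) / (D̄ - m p_ve)`. -/
def exponent (μ₀ : ℝ) (μ : Fin r → ℝ) : ℝ :=
  2 + (P.γ * P.Vbar + P.m * P.pve) / (P.Dbar μ₀ μ - P.m * P.pve)

end Model

/-- The distribution `p` on `ℕ` has a finite mean, equal to `μ`. -/
def HasMean (p : PMF ℕ) (μ : ℝ) : Prop := HasSum (fun n : ℕ => (p n).toReal * n) μ

end PrefAttach

end

/-! The proof is a first-moment recursion in `t` for the number `N_k` of vertices of degree `k`.
Given `H_t`, of total weight `W`, the expected number of draws in one step is `l = D̄ - m p_ve`, and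
each hits `v` with probability `(deg v + γ) / W`. Up to repeated hits, the expected change of `N_k`
is therefore `source k + l ((k - 1 + γ) N_{k-1} - (k + γ) N_k) / W`
(`abs_mean_step_numDegree_sub_le`).

The weight has constant drift `w = γ V̄ + D̄` and increments of order at most `c`, the bound on
cardinalities, so its second moment about `w s` is `O(s c²)` (`mean_run_sq_le`). Replacing `W` by `w
s` and discarding repeated hits costs `o(1)` when `c³ = o(s)`, which `c = t^(1/4)` satisfies. With
`ρ = l / w`, the recursion becomes `a (s + 1) = (1 - ρ (k + γ) / s) a s + const + o(1)`, so `a s /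
s` converges (`tendsto_div_of_recursion`). Induction on `k` gives the limits `degreeRate k`. Since
`|V_t|` concentrates around `V̄ t`, the fractions converge to `degreeRate k / V̄`.

The cardinality bounds hold only from some time `t₀` on, and before it only means are known to be
finite. Second moments are thus taken for the process restarted from a fixed `H_{t₀}`. The limit
does not depend on `H_{t₀}`, and the fractions are at most `1`, so dominated convergence averages
over it.

Above degree `m` there is no source, and consecutive limits have ratio `(m + γ + n) / (m + 1 + γ +
1/ρ + n)`. Euler's limit for the Gamma function turns this product into a power of `k` with exponent
`-(1 + 1/ρ) = -β`. -/

namespace PrefAttach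

/-! ### Expectations with respect to a probability mass function -/

section Mean

variable {α β : Type*}

/-- The expectation of `f` under `p`. -/
noncomputable def mean (p : PMF α) (f : α → ℝ) : ℝ := ∑' x, (p x).toReal * f x

/-- `f` is integrable under `p`. -/
def HasExp (p : PMF α) (f : α → ℝ) : Prop := Summable fun x => (p x).toReal * f x

theorem toReal_eq_zero_of_notMem {p : PMF α} {x : α} (h : x ∉ p.support) : (p x).toReal = 0 := by
  rw [PMF.mem_support_iff, not_not] at h
  simp [h]

theorem summable_toReal (p : PMF α) : Summable fun x => (p x).toReal :=
  ENNReal.summable_toReal p.tsum_coe_ne_top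

theorem tsum_toReal (p : PMF α) : ∑' x, (p x).toReal = 1 := by
  rw [← ENNReal.tsum_toReal_eq fun x => p.apply_ne_top x, p.tsum_coe, ENNReal.toReal_one]

theorem toReal_le_one (p : PMF α) (v : α) : (p v).toReal ≤ 1 :=
  ENNReal.toReal_le_of_le_ofReal zero_le_one (by simpa using p.coe_le_one v)

theorem HasExp.of_bdd {p : PMF α} {f : α → ℝ} {C : ℝ} (h : ∀ x ∈ p.support, |f x| ≤ C) :
    HasExp p f := by
  refine Summable.of_norm_bounded ((summable_toReal p).mul_right C) fun x => ?_
  by_cases hx : x ∈ p.support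
  · rw [norm_mul, Real.norm_eq_abs, Real.norm_eq_abs, abs_of_nonneg ENNReal.toReal_nonneg]
    exact mul_le_mul_of_nonneg_left (h x hx) ENNReal.toReal_nonneg
  · simp [toReal_eq_zero_of_notMem hx]

theorem HasExp.congr {p : PMF α} {f g : α → ℝ} (hf : HasExp p f)
    (h : ∀ x ∈ p.support, f x = g x) : HasExp p g := by
  refine Summable.congr hf fun x => ?_
  by_cases hx : x ∈ p.support
  · rw [h x hx]
  · simp [toReal_eq_zero_of_notMem hx]

theorem mean_congr {p : PMF α} {f g : α → ℝ} (h : ∀ x ∈ p.support, f x = g x) :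
    mean p f = mean p g := by
  refine tsum_congr fun x => ?_
  by_cases hx : x ∈ p.support
  · rw [h x hx]
  · simp [toReal_eq_zero_of_notMem hx]

theorem mean_mono {p : PMF α} {f g : α → ℝ} (hf : HasExp p f) (hg : HasExp p g)
    (h : ∀ x ∈ p.support, f x ≤ g x) : mean p f ≤ mean p g := by
  refine Summable.tsum_le_tsum (fun x => ?_) hf hg
  by_cases hx : x ∈ p.support
  · exact mul_le_mul_of_nonneg_left (h x hx) ENNReal.toReal_nonneg
  · simp [toReal_eq_zero_of_notMem hx]

theorem HasExp.const (p : PMF α) (c : ℝ) : HasExp p fun _ => c := (summable_toReal p).mul_right c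

theorem mean_const (p : PMF α) (c : ℝ) : (mean p fun _ => c) = c := by
  rw [mean, tsum_mul_right, tsum_toReal, one_mul]

theorem HasExp.add {p : PMF α} {f g : α → ℝ} (hf : HasExp p f) (hg : HasExp p g) :
    HasExp p fun x => f x + g x := by
  simpa only [HasExp, mul_add] using Summable.add hf hg

theorem mean_add {p : PMF α} {f g : α → ℝ} (hf : HasExp p f) (hg : HasExp p g) :
    (mean p fun x => f x + g x) = mean p f + mean p g := by
  simpa only [mean, mul_add] using Summable.tsum_add hf hg

theorem HasExp.sub {p : PMF α} {f g : α → ℝ} (hf : HasExp p f) (hg : HasExp p g) :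
    HasExp p fun x => f x - g x := by
  simpa only [HasExp, mul_sub] using Summable.sub hf hg

theorem mean_sub {p : PMF α} {f g : α → ℝ} (hf : HasExp p f) (hg : HasExp p g) :
    (mean p fun x => f x - g x) = mean p f - mean p g := by
  simpa only [mean, mul_sub] using Summable.tsum_sub hf hg

theorem HasExp.const_mul {p : PMF α} {f : α → ℝ} (c : ℝ) (hf : HasExp p f) :
    HasExp p fun x => c * f x := by
  simpa only [HasExp, mul_left_comm _ c] using Summable.mul_left c hf

theorem mean_const_mul (p : PMF α) (c : ℝ) (f : α → ℝ) :
    (mean p fun x => c * f x) = c * mean p f := by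
  simp only [mean, mul_left_comm _ c, tsum_mul_left]

theorem HasExp.sum {ι : Type*} {p : PMF α} {f : ι → α → ℝ} {s : Finset ι}
    (hf : ∀ i ∈ s, HasExp p (f i)) : HasExp p fun x => ∑ i ∈ s, f i x := by
  simpa only [HasExp, Finset.mul_sum] using summable_sum hf

theorem mean_sum {ι : Type*} {p : PMF α} {f : ι → α → ℝ} {s : Finset ι}
    (hf : ∀ i ∈ s, HasExp p (f i)) :
    (mean p fun x => ∑ i ∈ s, f i x) = ∑ i ∈ s, mean p (f i) := by
  simpa only [mean, Finset.mul_sum] using Summable.tsum_finsetSum hf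

theorem HasExp.abs {p : PMF α} {f : α → ℝ} (hf : HasExp p f) : HasExp p fun x => |f x| := by
  simpa only [HasExp, abs_mul, abs_of_nonneg ENNReal.toReal_nonneg] using Summable.abs hf

theorem mean_nonneg {p : PMF α} {f : α → ℝ} (h : ∀ x ∈ p.support, 0 ≤ f x) : 0 ≤ mean p f := by
  refine tsum_nonneg fun x => ?_
  by_cases hx : x ∈ p.support
  · exact mul_nonneg ENNReal.toReal_nonneg (h x hx)
  · simp [toReal_eq_zero_of_notMem hx]

theorem abs_mean_le {p : PMF α} {f : α → ℝ} (hf : HasExp p f) :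
    |mean p f| ≤ mean p fun x => |f x| := by
  rw [abs_le]
  constructor
  · have h := mean_mono (hf.abs.const_mul (-1)) hf fun x _ => by
      rw [neg_one_mul]; exact neg_abs_le (f x)
    rwa [mean_const_mul, neg_one_mul] at h
  · exact mean_mono hf hf.abs fun x _ => le_abs_self (f x)

theorem mean_le_of_le {p : PMF α} {f : α → ℝ} {C : ℝ} (hf : HasExp p f)
    (h : ∀ x ∈ p.support, f x ≤ C) : mean p f ≤ C :=
  (mean_mono hf (HasExp.const p C) h).trans_eq (mean_const p C)

theorem abs_mean_le_of_abs_le {p : PMF α} {f : α → ℝ} {C : ℝ}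
    (h : ∀ x ∈ p.support, |f x| ≤ C) : |mean p f| ≤ C :=
  (abs_mean_le (HasExp.of_bdd h)).trans (mean_le_of_le (HasExp.of_bdd h).abs h)

/-- Comparing expectations of functions that are close to each other. -/
theorem abs_mean_sub_mean_le {p : PMF α} {f g h : α → ℝ} (hf : HasExp p f) (hg : HasExp p g)
    (hh : HasExp p h) (hle : ∀ x ∈ p.support, |f x - g x| ≤ h x) :
    |mean p f - mean p g| ≤ mean p h := by
  rw [← mean_sub hf hg]
  exact (abs_mean_le (hf.sub hg)).trans (mean_mono (hf.sub hg).abs hh hle)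

/-- Cauchy–Schwarz against `1`: expand `0 ≤ E (|f| - M)²` with `M = E |f|`. -/
theorem mean_abs_sq_le {p : PMF α} {f : α → ℝ} (hf : HasExp p f) (hf2 : HasExp p fun x => f x ^ 2) :
    (mean p fun x => |f x|) ≤ √(mean p fun x => f x ^ 2) := by
  refine Real.le_sqrt_of_sq_le ?_
  set M := mean p fun x => |f x| with hM
  have h1 : 0 ≤ mean p fun x => (f x ^ 2 - 2 * M * |f x|) + M ^ 2 :=
    mean_nonneg fun x _ => by nlinarith [sq_nonneg (|f x| - M), sq_abs (f x)]
  rw [mean_add (hf2.sub (hf.abs.const_mul _)) (HasExp.const p _),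
    mean_sub hf2 (hf.abs.const_mul _), mean_const_mul, mean_const, ← hM] at h1
  nlinarith

theorem mean_pure (a : α) (f : α → ℝ) : mean (PMF.pure a) f = f a := by
  classical
  rw [mean, tsum_eq_single a fun b hb => by simp [PMF.pure_apply, hb]]
  simp [PMF.pure_apply]

theorem HasExp.pure (a : α) (f : α → ℝ) : HasExp (PMF.pure a) f :=
  HasExp.of_bdd (C := |f a|) fun x hx => by
    rw [PMF.support_pure, Set.mem_singleton_iff] at hx
    rw [hx]

/-- The law of total expectation. -/
theorem hasExp_bind_and_mean_bind {p : PMF α} {q : α → PMF β} {f : β → ℝ}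
    (h1 : ∀ a ∈ p.support, HasExp (q a) f)
    (h2 : HasExp p fun a => mean (q a) fun b => |f b|) :
    HasExp (p.bind q) f ∧ mean (p.bind q) f = mean p fun a => mean (q a) f := by
  set F : α × β → ℝ := fun x => (p x.1).toReal * ((q x.1 x.2).toReal * f x.2) with hF
  have key : ∀ b, ((p.bind q) b).toReal * f b = ∑' a, F (a, b) := fun b => by
    rw [PMF.bind_apply, ENNReal.tsum_toReal_eq fun a =>
      ENNReal.mul_ne_top (p.apply_ne_top a) ((q a).apply_ne_top b), ← tsum_mul_right]
    simp [hF, ENNReal.toReal_mul, mul_assoc]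
  -- Fubini on `α × β`: the rows are summable by `h1`, and `h2` says that their norms are summable.
  have hsum : Summable F := by
    refine Summable.of_norm ((summable_prod_of_nonneg fun _ => norm_nonneg _).2 ⟨fun a => ?_, ?_⟩)
    · by_cases ha : a ∈ p.support
      · exact (Summable.mul_left (p a).toReal (h1 a ha)).norm
      · simp [hF, toReal_eq_zero_of_notMem ha]
    · have hnorm : ∀ a, ∑' b, ‖F (a, b)‖ = (p a).toReal * mean (q a) fun b => |f b| := fun a => by
        rw [mean, ← tsum_mul_left]
        refine tsum_congr fun b => ?_
        rw [Real.norm_eq_abs, abs_mul, abs_mul, ENNReal.abs_toReal, ENNReal.abs_toReal]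
      exact (summable_congr hnorm).2 h2
  refine ⟨Summable.congr hsum.prod_symm.prod fun b => (key b).symm, ?_⟩
  rw [mean, tsum_congr key, Summable.tsum_comm (f := fun a b => F (a, b)) hsum]
  refine tsum_congr fun a => ?_
  change _ = (p a).toReal * ∑' b, _
  rw [← tsum_mul_left]

theorem mean_bind_of_bdd {p : PMF α} {q : α → PMF β} {f : β → ℝ} {C : ℝ}
    (h : ∀ a ∈ p.support, ∀ b ∈ (q a).support, |f b| ≤ C) :
    mean (p.bind q) f = mean p fun a => mean (q a) f :=
  (hasExp_bind_and_mean_bind (fun a ha => HasExp.of_bdd (h a ha))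
    (HasExp.of_bdd fun a ha => abs_mean_le_of_abs_le fun b hb => by
      rw [abs_abs]; exact h a ha b hb)).2

theorem hasExp_map {p : PMF α} {φ : α → β} {f : β → ℝ} (h : HasExp p fun a => f (φ a)) :
    HasExp (p.map φ) f ∧ mean (p.map φ) f = mean p fun a => f (φ a) := by
  have := hasExp_bind_and_mean_bind (p := p) (q := fun a => PMF.pure (φ a)) (f := f)
    (fun a _ => HasExp.pure _ _) (by simpa only [mean_pure] using h.abs)
  simp only [mean_pure] at this
  exact this

/-- One step of the second moment of a process with bounded increments of constant mean. -/
theorem mean_sq_bind_le {p : PMF α} {q : α → PMF α} {Z : α → ℝ} {z B C : ℝ} (c : ℝ)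
    (hC : ∀ a ∈ p.support, |Z a| ≤ C)
    (hB : ∀ a ∈ p.support, ∀ b ∈ (q a).support, |Z b - Z a| ≤ B)
    (hz : ∀ a ∈ p.support, mean (q a) Z = Z a + z) :
    (mean (p.bind q) fun b => (Z b - (c + z)) ^ 2) ≤ (mean p fun a => (Z a - c) ^ 2) + B ^ 2 := by
  have hq : ∀ a ∈ p.support, ∀ b ∈ (q a).support, |Z b| ≤ C + B := fun a ha b hb => by
    have h1 := hC a ha
    have h2 := hB a ha b hb
    rw [abs_le] at *
    constructor <;> linarith
  have hsq : ∀ (d D x : ℝ), |x| ≤ D → |(x - d) ^ 2| ≤ (D + |d|) ^ 2 := fun d D x hx => by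
    rw [abs_pow]
    exact pow_le_pow_left₀ (abs_nonneg _) ((abs_sub _ _).trans (by linarith)) 2
  rw [mean_bind_of_bdd fun a ha b hb => hsq _ _ _ (hq a ha b hb),
    ← mean_const p (B ^ 2), ← mean_add (HasExp.of_bdd fun a ha => hsq _ _ _ (hC a ha))
      (HasExp.const p _)]
  have hstep : ∀ a ∈ p.support,
      (mean (q a) fun b => (Z b - (c + z)) ^ 2) ≤ (Z a - c) ^ 2 + B ^ 2 := fun a ha => by
    have e1 : HasExp (q a) Z := HasExp.of_bdd (hq a ha)
    have e2 : HasExp (q a) fun b => (Z b - Z a) ^ 2 :=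
      HasExp.of_bdd fun b hb => hsq _ _ _ (hq a ha b hb)
    -- In this form the drift `hz` evaluates the linear term. The conditional mean is `E (Z b - Z
    -- a)² + (Z a - c)² - z²`, and `-z²` is dropped.
    have heq : ∀ b, (Z b - (c + z)) ^ 2 =
        ((Z b - Z a) ^ 2 + 2 * (Z a - c - z) * Z b) + ((Z a - c - z) ^ 2 - 2 * (Z a - c - z) * Z a) :=
      fun b => by ring
    have hvar : (mean (q a) fun b => (Z b - Z a) ^ 2) ≤ B ^ 2 :=
      mean_le_of_le e2 fun b hb => sq_le_sq.2 ((hB a ha b hb).trans (le_abs_self B))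
    simp only [heq]
    rw [mean_add (e2.add (e1.const_mul _)) (HasExp.const _ _), mean_add e2 (e1.const_mul _),
      mean_const_mul, mean_const, hz a ha]
    nlinarith [sq_nonneg z]
  refine mean_mono (HasExp.of_bdd (C := (C + B + |c + z|) ^ 2) fun a ha =>
    abs_mean_le_of_abs_le fun b hb => hsq _ _ _ (hq a ha b hb))
    ((HasExp.of_bdd fun a ha => hsq _ _ _ (hC a ha)).add (HasExp.const p _)) hstep

/-- A mixture of convergent, uniformly bounded expectations converges. -/
theorem tendsto_mean {p : PMF α} {F : ℕ → α → ℝ} {L C : ℝ}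
    (hC : ∀ s, ∀ a ∈ p.support, |F s a| ≤ C)
    (hF : ∀ a ∈ p.support, Tendsto (fun s => F s a) atTop (𝓝 L)) :
    Tendsto (fun s => mean p (F s)) atTop (𝓝 L) := by
  rw [← mean_const p L]
  refine tendsto_tsum_of_dominated_convergence ((summable_toReal p).mul_right C) (fun a => ?_)
    (Eventually.of_forall fun s a => ?_)
  · by_cases ha : a ∈ p.support
    · exact (hF a ha).const_mul _
    · simp [toReal_eq_zero_of_notMem ha]
  · by_cases ha : a ∈ p.support
    · rw [norm_mul, Real.norm_eq_abs, Real.norm_eq_abs, abs_of_nonneg ENNReal.toReal_nonneg]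
      exact mul_le_mul_of_nonneg_left (hC s a ha) ENNReal.toReal_nonneg
    · simp [toReal_eq_zero_of_notMem ha]

end Mean

/-! ### Independent draws -/

section Draws

variable {α : Type}

theorem card_of_mem_support_draws {p : PMF α} {n : ℕ} {s : Multiset α}
    (hs : s ∈ (draws p n).support) : s.card = n := by
  induction n generalizing s with
  | zero =>
    rw [draws, PMF.support_pure, Set.mem_singleton_iff] at hs
    simp [hs]
  | succ n ih =>
    rw [draws, PMF.mem_support_bind_iff] at hs
    obtain ⟨a, -, ha⟩ := hs
    obtain ⟨u, hu, rfl⟩ := (PMF.mem_support_map_iff _ _ _).1 ha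
    rw [Multiset.card_cons, ih hu]

theorem mem_support_of_mem_draws {p : PMF α} {n : ℕ} {s : Multiset α}
    (hs : s ∈ (draws p n).support) : ∀ a ∈ s, a ∈ p.support := by
  induction n generalizing s with
  | zero =>
    rw [draws, PMF.support_pure, Set.mem_singleton_iff] at hs
    simp [hs]
  | succ n ih =>
    rw [draws, PMF.mem_support_bind_iff] at hs
    obtain ⟨a, haa, ha⟩ := hs
    obtain ⟨u, hu, rfl⟩ := (PMF.mem_support_map_iff _ _ _).1 ha
    intro b hb
    rcases Multiset.mem_cons.1 hb with rfl | hb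
    · exact haa
    · exact ih hu b hb

theorem card_sum_of_mem_support_draws {p : PMF α} {n m : ℕ} {s : Multiset (Multiset α)}
    (hs : s ∈ (draws (draws p n) m).support) : s.sum.card = m * n := by
  rw [← Multiset.join, Multiset.card_join, Multiset.eq_replicate.2 ⟨Multiset.card_map _ _, _⟩,
    Multiset.sum_replicate, card_of_mem_support_draws hs, smul_eq_mul]
  intro c hc
  obtain ⟨u, hu, rfl⟩ := Multiset.mem_map.1 hc
  exact card_of_mem_support_draws (mem_support_of_mem_draws hs u hu)

theorem draws_add (p : PMF α) (a b : ℕ) :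
    draws p (a + b) = (draws p a).bind fun s => (draws p b).map fun u => s + u := by
  induction a with
  | zero =>
    simp only [draws, PMF.pure_bind, zero_add]
    exact (PMF.map_id _).symm
  | succ a ih =>
    rw [Nat.succ_add, draws, ih, draws, PMF.bind_bind]
    congr 1; funext x
    rw [PMF.map_bind, PMF.bind_map]
    congr 1; funext s
    rw [PMF.map_comp, Function.comp_apply]
    congr 1; funext u
    simp

/-- Degrees see only the pooled multiset `es.sum`, so how the draws are grouped into `m` hyperedges
is irrelevant. -/
theorem map_sum_draws (p : PMF α) (n m : ℕ) :
    (draws (draws p n) m).map Multiset.sum = draws p (m * n) := by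
  induction m with
  | zero => simp [draws, PMF.pure_map]
  | succ m ih =>
    rw [Nat.succ_mul, Nat.add_comm (m * n), draws_add p n, show draws (draws p n) (m + 1) =
      (draws p n).bind fun a => (draws (draws p n) m).map fun s => a ::ₘ s from rfl, PMF.map_bind]
    congr 1; funext s
    rw [← ih, PMF.map_comp, PMF.map_comp]
    congr 1; funext u
    simp

variable [DecidableEq α]

/-- Condition on whether the first draw is `v`. -/
theorem mean_draws_succ {p : PMF α} (v : α) (n : ℕ) {g : ℕ → ℝ} {C : ℝ} (hg : ∀ j, |g j| ≤ C) :
    (mean (draws p (n + 1)) fun s => g (s.count v)) =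
      (1 - (p v).toReal) * (mean (draws p n) fun s => g (s.count v)) +
        (p v).toReal * mean (draws p n) fun s => g (s.count v + 1) := by
  rw [draws, mean_bind_of_bdd fun _ _ _ _ => hg _]
  have h : ∀ a, (mean ((draws p n).map fun s => a ::ₘ s) fun s => g (s.count v)) =
      (mean (draws p n) fun s => g (s.count v)) + (if a = v then 1 else 0) *
        ((mean (draws p n) fun s => g (s.count v + 1)) - mean (draws p n) fun s => g (s.count v)) :=
    fun a => by
    rw [(hasExp_map (φ := fun s => a ::ₘ s) (f := fun s => g (s.count v))
      (HasExp.of_bdd fun _ _ => hg _)).2]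
    split_ifs with hav
    · subst hav; simp
    · simp [Multiset.count_cons_of_ne (Ne.symm hav)]
  simp only [h]
  have hone : (mean p fun a => if a = v then (1 : ℝ) else 0) = (p v).toReal := by
    rw [mean, tsum_eq_single v fun b hb => by simp [hb]]
    simp
  rw [mean_add (HasExp.const _ _) (HasExp.of_bdd (C := 2 * C) fun a _ => ?_), mean_const]
  · simp only [mul_comm (if _ then _ else _), mean_const_mul, hone]
    ring
  · have h1 := abs_mean_le_of_abs_le (p := draws p n) fun s _ => hg (s.count v)
    have h2 := abs_mean_le_of_abs_le (p := draws p n) fun s _ => hg (s.count v + 1)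
    split_ifs
    · rw [one_mul]
      exact (abs_sub _ _).trans (by linarith)
    · simp; linarith [abs_nonneg (g 0), hg 0]

/-- Union bound: some draw hits `v` with probability at most `n p(v)`, and `g` varies by at most
`1`. -/
theorem abs_mean_draws_sub_zero_le {p : PMF α} (v : α) (n : ℕ) {g : ℕ → ℝ}
    (h0 : ∀ j, 0 ≤ g j) (h1 : ∀ j, g j ≤ 1) :
    |(mean (draws p n) fun s => g (s.count v)) - g 0| ≤ n * (p v).toReal := by
  have hg : ∀ j, |g j| ≤ 1 := fun j => by rw [abs_of_nonneg (h0 j)]; exact h1 j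
  have hp := ENNReal.toReal_nonneg (a := p v)
  have hp1 := toReal_le_one p v
  induction n with
  | zero => simp [draws, mean_pure]
  | succ n ih =>
    rw [mean_draws_succ v n hg]
    have a1 : 0 ≤ mean (draws p n) fun s => g (s.count v + 1) := mean_nonneg fun s _ => h0 _
    have a2 : (mean (draws p n) fun s => g (s.count v + 1)) ≤ 1 :=
      mean_le_of_le (HasExp.of_bdd fun s _ => hg _) fun s _ => h1 _
    generalize (mean (draws p n) fun s => g (s.count v)) = A at *
    generalize (mean (draws p n) fun s => g (s.count v + 1)) = B at *
    have h00 := h0 0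
    have h10 := h1 0
    push_cast
    have e : (1 - (p v).toReal) * A + (p v).toReal * B - g 0 =
      (1 - (p v).toReal) * (A - g 0) + (p v).toReal * (B - g 0) := by ring
    rw [e]
    refine (abs_add_le _ _).trans ?_
    rw [abs_mul, abs_mul, abs_of_nonneg hp, abs_of_nonneg (sub_nonneg.2 hp1)]
    have b1 : |B - g 0| ≤ 1 := abs_le.2 ⟨by linarith, by linarith⟩
    nlinarith [abs_nonneg (A - g 0)]

/-- The error comes from two or more draws hitting `v`, an event of probability of order `(n
p(v))²`. -/
theorem abs_mean_draws_sub_le_sq {p : PMF α} (v : α) (n : ℕ) {g : ℕ → ℝ}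
    (h0 : ∀ j, 0 ≤ g j) (h1 : ∀ j, g j ≤ 1) :
    |(mean (draws p n) fun s => g (s.count v)) -
      ((1 - n * (p v).toReal) * g 0 + n * (p v).toReal * g 1)| ≤ (n * (p v).toReal) ^ 2 := by
  have hg : ∀ j, |g j| ≤ 1 := fun j => by rw [abs_of_nonneg (h0 j)]; exact h1 j
  have hp := ENNReal.toReal_nonneg (a := p v)
  have hp1 := toReal_le_one p v
  induction n with
  | zero => simp [draws, mean_pure]
  | succ n ih =>
    rw [mean_draws_succ v n hg]
    -- The crude bound for the shifted `g` covers a first draw that hits `v`. The three errors add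
    -- up to at most `(n² + 2n) x² ≤ ((n + 1) x)²`.
    have a1 := abs_mean_draws_sub_zero_le (p := p) v n (g := fun j => g (j + 1))
      (fun j => h0 _) fun j => h1 _
    simp only [zero_add] at a1
    generalize (mean (draws p n) fun s => g (s.count v)) = A at *
    generalize (mean (draws p n) fun s => g (s.count v + 1)) = B at *
    generalize (p v).toReal = x at *
    have b : |g 0 - g 1| ≤ 1 := abs_le.2 ⟨by linarith [h0 0, h1 1], by linarith [h0 1, h1 0]⟩
    push_cast
    have e : (1 - x) * A + x * B - ((1 - (n + 1) * x) * g 0 + (n + 1) * x * g 1) =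
      (1 - x) * (A - ((1 - n * x) * g 0 + n * x * g 1)) + (n * x ^ 2 * (g 0 - g 1) +
        x * (B - g 1)) := by ring
    rw [e]
    refine (abs_add_le _ _).trans ((add_le_add le_rfl (abs_add_le _ _)).trans ?_)
    have hn : (0 : ℝ) ≤ n := n.cast_nonneg
    rw [abs_mul (1 - x), abs_mul x, abs_mul (n * x ^ 2), abs_of_nonneg hp,
      abs_of_nonneg (sub_nonneg.2 hp1), abs_of_nonneg (by positivity : 0 ≤ n * x ^ 2)]
    have c1 := mul_le_mul_of_nonneg_left b (by positivity : 0 ≤ n * x ^ 2)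
    have c2 := mul_le_mul_of_nonneg_left a1 hp
    have c3 : (1 - x) * |A - ((1 - n * x) * g 0 + n * x * g 1)| ≤ (n * x) ^ 2 :=
      (mul_le_of_le_one_left (abs_nonneg _) (by linarith)).trans ih
    nlinarith [sq_nonneg x]

/-- To first order, at most one of `n` draws hits `v`. -/
theorem abs_mean_draws_sub_le {p : PMF α} (v : α) (n : ℕ) {g : ℕ → ℝ}
    (h0 : ∀ j, 0 ≤ g j) (h1 : ∀ j, g j ≤ 1) :
    |(mean (draws p n) fun s => g (s.count v)) -
      ((1 - n * (p v).toReal) * g 0 + n * (p v).toReal * g 1)| ≤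
      2 * (n * (p v).toReal) * min 1 (n * (p v).toReal) := by
  have hx : 0 ≤ n * (p v).toReal := mul_nonneg n.cast_nonneg ENNReal.toReal_nonneg
  have e1 := abs_mean_draws_sub_le_sq (p := p) v n h0 h1
  have e2 := abs_mean_draws_sub_zero_le (p := p) v n h0 h1
  generalize (mean (draws p n) fun s => g (s.count v)) = A at *
  generalize n * (p v).toReal = x at *
  -- For `x ≥ 1` the quadratic bound is too weak; the linear one gives `x + x`.
  rcases min_cases 1 x with ⟨h, h'⟩ | ⟨h, h'⟩
  · rw [h]
    have b : |g 0 - g 1| ≤ 1 := abs_le.2 ⟨by linarith [h0 0, h1 1], by linarith [h0 1, h1 0]⟩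
    have e : A - ((1 - x) * g 0 + x * g 1) = (A - g 0) + x * (g 0 - g 1) := by ring
    rw [e]
    refine (abs_add_le _ _).trans ?_
    rw [abs_mul, abs_of_nonneg hx]
    nlinarith
  · rw [h]
    nlinarith [sq_nonneg x]

end Draws

end PrefAttach

namespace PrefAttach

namespace MultiHypergraph

/-! ### Degrees after adding hyperedges -/

variable (H : MultiHypergraph)

theorem count_multiset_sum {n : ℕ} (s : Multiset (Multiset (Fin n))) (v : Fin n) :
    s.sum.count v = (s.map fun e => e.count v).sum := by
  simpa using Multiset.count_sum (m := s) (f := id) (a := v)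

theorem degree_addEdges (es : Multiset (Multiset (Fin H.order))) (v : Fin H.order) :
    (H.addEdges es).degree v = H.degree v + es.sum.count v := by
  rw [degree, addEdges, Multiset.map_add, Multiset.sum_add, ← degree, Multiset.map_map,
    count_multiset_sum]
  congr 3
  funext e
  exact Multiset.count_map_eq_count' _ _ Fin.val_injective v

theorem degree_addVertex (es : Multiset (Multiset (Fin H.order))) (v : Fin H.order) :
    (H.addVertex es).degree v = H.degree v + es.sum.count v := by
  rw [degree, addVertex, Multiset.map_add, Multiset.sum_add, ← degree, Multiset.map_map,
    count_multiset_sum]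
  congr 3
  funext e
  rw [Function.comp_apply, Multiset.count_cons_of_ne v.isLt.ne]
  exact Multiset.count_map_eq_count' _ _ Fin.val_injective v

theorem degree_addVertex_order (es : Multiset (Multiset (Fin H.order))) :
    (H.addVertex es).degree H.order = es.card := by
  rw [degree, addVertex, Multiset.map_add, Multiset.sum_add, Multiset.map_map]
  have h1 : (H.edges.map fun e => e.count H.order).sum = 0 :=
    Multiset.sum_eq_zero fun x hx => by
      obtain ⟨e, he, rfl⟩ := Multiset.mem_map.1 hx
      exact Multiset.count_eq_zero.2 fun h => lt_irrefl _ (H.lt_order e he _ h)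
  have h2 : ∀ e : Multiset (Fin H.order), (H.order ::ₘ e.map Fin.val).count H.order = 1 :=
    fun e => by
      rw [Multiset.count_cons_self, Multiset.count_eq_zero.2 fun h => ?_]
      obtain ⟨w, -, hw⟩ := Multiset.mem_map.1 h
      exact w.isLt.ne hw
  rw [h1]
  simp only [Function.comp_def, h2]
  simp

theorem sum_count_fin {n : ℕ} (s : Multiset (Fin n)) : ∑ v, s.count v = s.card :=
  Multiset.sum_count_eq_card fun _ _ => Finset.mem_univ _

theorem sum_range_addEdges (es : Multiset (Multiset (Fin H.order))) (F : ℕ → ℝ) :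
    ∑ v ∈ Finset.range (H.addEdges es).order, F ((H.addEdges es).degree v) =
      ∑ v : Fin H.order, F (H.degree v + es.sum.count v) := by
  change ∑ v ∈ Finset.range H.order, F ((H.addEdges es).degree v) = _
  rw [← Fin.sum_univ_eq_sum_range fun v => F ((H.addEdges es).degree v)]
  exact Finset.sum_congr rfl fun v _ => by rw [← degree_addEdges]

theorem sum_range_addVertex (es : Multiset (Multiset (Fin H.order))) (F : ℕ → ℝ) :
    ∑ v ∈ Finset.range (H.addVertex es).order, F ((H.addVertex es).degree v) =
      ∑ v : Fin H.order, F (H.degree v + es.sum.count v) + F es.card := by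
  rw [show (H.addVertex es).order = H.order + 1 from rfl, Finset.sum_range_succ,
    degree_addVertex_order, ← Fin.sum_univ_eq_sum_range fun v => F ((H.addVertex es).degree v)]
  congr 1
  exact Finset.sum_congr rfl fun v _ => by rw [← degree_addVertex]

theorem sum_range_degree (F : ℕ → ℝ) :
    ∑ v ∈ Finset.range H.order, F (H.degree v) = ∑ v : Fin H.order, F (H.degree v) :=
  (Fin.sum_univ_eq_sum_range (fun v => F (H.degree v)) _).symm

theorem coe_weight (γ : ℝ≥0) :
    (H.weight γ : ℝ) = ∑ v ∈ Finset.range H.order, ((H.degree v : ℝ) + γ) := by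
  simp [weight]

theorem coe_totalDegree :
    (H.totalDegree : ℝ) = ∑ v ∈ Finset.range H.order, (H.degree v : ℝ) := by
  simp [totalDegree]

theorem coe_numDegree (k : ℕ) :
    (H.numDegree k : ℝ) = ∑ v ∈ Finset.range H.order, if H.degree v = k then (1 : ℝ) else 0 := by
  simp [numDegree]

theorem numDegree_le (k : ℕ) : H.numDegree k ≤ H.order :=
  (Finset.card_filter_le _ _).trans_eq (Finset.card_range _)

/-- The sum of `deg v + γ` over the vertices `v` with `deg v + 1 = k`. -/
noncomputable def prevWeight (γ : ℝ≥0) (k : ℕ) : ℝ :=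
  ∑ v : Fin H.order, if H.degree v + 1 = k then (H.degree v : ℝ) + γ else 0

theorem prevWeight_zero (γ : ℝ≥0) : H.prevWeight γ 0 = 0 := by
  simp [prevWeight]

/-- The inflow into degree `k + 1`. Indexing by `deg v + 1 = k` avoids `k - 1`, so `k = 0` needs no
separate treatment in the one-step estimate. -/
theorem prevWeight_succ (γ : ℝ≥0) (k : ℕ) :
    H.prevWeight γ (k + 1) = (k + γ) * H.numDegree k := by
  rw [prevWeight, coe_numDegree, H.sum_range_degree fun d => if d = k then (1 : ℝ) else 0,
    Finset.mul_sum]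
  refine Finset.sum_congr rfl fun v _ => ?_
  by_cases h : H.degree v = k <;> simp [h]

theorem mul_numDegree_le_weight (γ : ℝ≥0) (k : ℕ) : (k + γ) * (H.numDegree k : ℝ) ≤ H.weight γ := by
  rw [← prevWeight_succ, prevWeight, coe_weight,
    H.sum_range_degree fun d => (d : ℝ) + γ]
  refine Finset.sum_le_sum fun v _ => ?_
  have : (0 : ℝ) ≤ (H.degree v : ℝ) + γ := by positivity
  split_ifs <;> linarith

theorem toReal_chooseVertex {γ : ℝ≥0} (h : H.weight γ ≠ 0) (v : Fin H.order) :
    (H.chooseVertex γ v).toReal = ((H.degree v : ℝ) + γ) / H.weight γ := by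
  rw [chooseVertex, dif_neg h, PMF.ofFintype_apply]
  simp

theorem sum_toReal_chooseVertex (γ : ℝ≥0) : ∑ v, (H.chooseVertex γ v).toReal = 1 := by
  rw [← tsum_toReal (H.chooseVertex γ), tsum_fintype]

/-- The expected number of old vertices of degree `k` after `n` draws, to first order. -/
theorem abs_mean_draws_sum_sub_le {γ : ℝ≥0} (h : H.weight γ ≠ 0) (k n : ℕ) :
    |(mean (draws (H.chooseVertex γ) n) fun s =>
        ∑ v : Fin H.order, if H.degree v + s.count v = k then (1 : ℝ) else 0) -
      (H.numDegree k + n * ((H.prevWeight γ k - (k + γ) * H.numDegree k) / H.weight γ))| ≤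
      2 * n * min 1 ((n : ℝ) * ((k + γ) / H.weight γ)) := by
  have hW : (0 : ℝ) < H.weight γ := by
    have := pos_iff_ne_zero.2 h
    exact_mod_cast this
  set g : Fin H.order → ℕ → ℝ := fun v j => if H.degree v + j = k then 1 else 0 with hg
  set p : Fin H.order → ℝ := fun v => (H.chooseVertex γ v).toReal with hp
  have g0 : ∀ v j, 0 ≤ g v j := fun v j => by simp only [hg]; split_ifs <;> norm_num
  have g1 : ∀ v j, g v j ≤ 1 := fun v j => by simp only [hg]; split_ifs <;> norm_num
  have hp0 : ∀ v, 0 ≤ p v := fun v => ENNReal.toReal_nonneg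
  have hsum : (mean (draws (H.chooseVertex γ) n) fun s =>
      ∑ v : Fin H.order, if H.degree v + s.count v = k then (1 : ℝ) else 0) =
      ∑ v, mean (draws (H.chooseVertex γ) n) fun s => g v (s.count v) :=
    mean_sum (f := fun v (s : Multiset (Fin H.order)) => g v (s.count v)) fun v _ => HasExp.of_bdd (C := 1) fun s _ => by
      rw [abs_of_nonneg (g0 _ _)]; exact g1 _ _
  rw [hsum]
  have hmain : (H.numDegree k : ℝ) +
      n * ((H.prevWeight γ k - (k + γ) * H.numDegree k) / H.weight γ) =
      ∑ v, ((1 - n * p v) * g v 0 + n * p v * g v 1) := by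
    rw [← H.prevWeight_succ, coe_numDegree,
      H.sum_range_degree fun d => if d = k then (1 : ℝ) else 0, prevWeight, prevWeight,
      ← Finset.sum_sub_distrib, Finset.sum_div, Finset.mul_sum, ← Finset.sum_add_distrib]
    refine Finset.sum_congr rfl fun v _ => ?_
    simp only [hg, hp, H.toReal_chooseVertex h, add_zero, add_left_inj]
    split_ifs <;> ring
  rw [hmain, ← Finset.sum_sub_distrib]
  have hv : ∀ v, |(mean (draws (H.chooseVertex γ) n) fun s => g v (s.count v)) -
      ((1 - n * p v) * g v 0 + n * p v * g v 1)| ≤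
      2 * n * min 1 ((n : ℝ) * ((k + γ) / H.weight γ)) * p v := fun v => by
    -- Degrees never decrease, so a vertex of degree above `k` contributes nothing. For the others
    -- `p v ≤ (k + γ) / W`; one factor `p v` is kept outside the minimum because these sum to `1`.
    by_cases hk : H.degree v ≤ k
    · refine (abs_mean_draws_sub_le v n (g0 v) (g1 v)).trans ?_
      have hpv : p v ≤ (k + γ) / H.weight γ := by
        simp only [hp, H.toReal_chooseVertex h]
        gcongr
      have := hp0 v
      calc 2 * (n * p v) * min 1 (n * p v)
          ≤ 2 * (n * p v) * min 1 ((n : ℝ) * ((k + γ) / H.weight γ)) := by gcongr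
        _ = _ := by ring
    · have hz : ∀ j, g v j = 0 := fun j => if_neg (by omega)
      simp only [hz, mean_const]
      have := hp0 v
      simp only [mul_zero, add_zero, sub_self, abs_zero]
      positivity
  refine (Finset.abs_sum_le_sum_abs _ _).trans ((Finset.sum_le_sum fun v _ => hv v).trans ?_)
  rw [← Finset.mul_sum, H.sum_toReal_chooseVertex, mul_one]

/-- `f` grows by `a` with every new vertex and by `b` with every new incidence. -/
structure IsAdditive (f : MultiHypergraph → ℝ) (a b : ℝ) : Prop where
  addEdges : ∀ H (es : Multiset (Multiset (Fin H.order))),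
    f (H.addEdges es) = f H + b * es.sum.card
  addVertex : ∀ H (es : Multiset (Multiset (Fin H.order))),
    f (H.addVertex es) = f H + a + b * (es.card + es.sum.card)

theorem isAdditive_order : IsAdditive (fun H => (H.order : ℝ)) 1 0 where
  addEdges H es := by simp [MultiHypergraph.addEdges]
  addVertex H es := by simp [MultiHypergraph.addVertex]

theorem isAdditive_weight (γ : ℝ≥0) : IsAdditive (fun H => (H.weight γ : ℝ)) γ 1 where
  addEdges H es := by
    simp only [coe_weight]
    rw [H.sum_range_addEdges es fun d => (d : ℝ) + γ, H.sum_range_degree fun d => (d : ℝ) + γ,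
      ← sum_count_fin, Nat.cast_sum, one_mul, ← Finset.sum_add_distrib]
    exact Finset.sum_congr rfl fun v _ => by push_cast; ring
  addVertex H es := by
    simp only [coe_weight]
    rw [H.sum_range_addVertex es fun d => (d : ℝ) + γ, H.sum_range_degree fun d => (d : ℝ) + γ,
      ← sum_count_fin, Nat.cast_sum, one_mul]
    have : ∑ v : Fin H.order, (((H.degree v + es.sum.count v : ℕ) : ℝ) + γ) =
        ∑ v : Fin H.order, ((H.degree v : ℝ) + γ) + ∑ v : Fin H.order, (es.sum.count v : ℝ) := by
      rw [← Finset.sum_add_distrib]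
      exact Finset.sum_congr rfl fun v _ => by push_cast; ring
    rw [this]; ring

theorem isAdditive_totalDegree : IsAdditive (fun H => (H.totalDegree : ℝ)) 0 1 := by
  have h : ∀ H : MultiHypergraph, (H.totalDegree : ℝ) = H.weight 0 := fun H => by
    simp [coe_weight, coe_totalDegree]
  simpa only [h, NNReal.coe_zero] using isAdditive_weight 0

end MultiHypergraph

/-! ### One time step -/

theorem HasMean.hasExp {p : PMF ℕ} {μ : ℝ} (h : HasMean p μ) : HasExp p fun n => (n : ℝ) :=
  h.summable

theorem HasMean.mean_eq {p : PMF ℕ} {μ : ℝ} (h : HasMean p μ) : (mean p fun n => (n : ℝ)) = μ :=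
  h.tsum_eq

namespace Model

variable {r : ℕ} (P : Model r)

/-- The distribution of `H_{t+1}` given `H_t = H` and the kind of event. -/
noncomputable def eventStep (t : ℕ) (H : MultiHypergraph) : Event r → PMF MultiHypergraph
  | .vertex => PMF.pure (H.addVertex 0)
  | .vertexEdges => (P.Y t).bind fun y =>
      (draws (draws (H.chooseVertex P.γ) (y - 1)) P.m).map H.addVertex
  | .edges i => (P.X i t).bind fun x =>
      (draws (draws (H.chooseVertex P.γ) x) P.m).map H.addEdges
  | .nothing => PMF.pure H

theorem step_eq_bind (t : ℕ) (H : MultiHypergraph) :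
    P.step t H = P.eventLaw.bind (P.eventStep t H) := by
  rw [step]
  congr 1

/-- The possible values of `H_{t+1}` given `H_t = H`, up to the mutual order of the draws. -/
inductive IsNext (t : ℕ) (H : MultiHypergraph) : MultiHypergraph → Prop
  | vertex : IsNext t H (H.addVertex 0)
  | vertexEdges (y : ℕ) (hy : y ∈ (P.Y t).support) (es : Multiset (Multiset (Fin H.order)))
      (hes : es.card = P.m) (hsum : es.sum.card = P.m * (y - 1)) : IsNext t H (H.addVertex es)
  | edges (i : Fin r) (x : ℕ) (hx : x ∈ (P.X i t).support)
      (es : Multiset (Multiset (Fin H.order))) (hsum : es.sum.card = P.m * x) :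
      IsNext t H (H.addEdges es)
  | nothing : IsNext t H H

variable {P}

theorem isNext_of_mem_eventStep {t : ℕ} {H H' : MultiHypergraph} {e : Event r}
    (h : H' ∈ (P.eventStep t H e).support) : P.IsNext t H H' := by
  cases e with
  | vertex =>
    rw [eventStep, PMF.support_pure, Set.mem_singleton_iff] at h
    subst h; exact .vertex
  | vertexEdges =>
    rw [eventStep, PMF.mem_support_bind_iff] at h
    obtain ⟨y, hy, h⟩ := h
    obtain ⟨es, hes, rfl⟩ := (PMF.mem_support_map_iff _ _ _).1 h
    exact .vertexEdges y hy es (card_of_mem_support_draws hes) (card_sum_of_mem_support_draws hes)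
  | edges i =>
    rw [eventStep, PMF.mem_support_bind_iff] at h
    obtain ⟨y, hy, h⟩ := h
    obtain ⟨es, hes, rfl⟩ := (PMF.mem_support_map_iff _ _ _).1 h
    exact .edges i y hy es (card_sum_of_mem_support_draws hes)
  | nothing =>
    rw [eventStep, PMF.support_pure, Set.mem_singleton_iff] at h
    subst h; exact .nothing

theorem isNext_of_mem_step {t : ℕ} {H H' : MultiHypergraph} (h : H' ∈ (P.step t H).support) :
    P.IsNext t H H' := by
  rw [step_eq_bind, PMF.mem_support_bind_iff] at h
  obtain ⟨e, -, h⟩ := h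
  exact isNext_of_mem_eventStep h

variable (P)

/-- The expectation over one step as a sum over the kinds of events. -/
theorem hasExp_step {t : ℕ} {H : MultiHypergraph} {f : MultiHypergraph → ℝ}
    (h : ∀ e, HasExp (P.eventStep t H e) f) :
    HasExp (P.step t H) f ∧ mean (P.step t H) f =
      ∑ i, P.pe i * mean (P.eventStep t H (.edges i)) f + (P.pv * f (H.addVertex 0) +
        P.pve * mean (P.eventStep t H .vertexEdges) f +
        (1 - (P.pv + P.pve + ∑ i, (P.pe i : ℝ))) * f H) := by
  have hfin : ∀ (ι : Type) [Fintype ι] (p : PMF ι) (g : ι → ℝ),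
      HasExp p g := fun ι _ p g => (hasSum_fintype _).summable
  have hmean : ∀ (ι : Type) [Fintype ι] (w : ι → ℝ≥0∞) (hw : ∑ i, w i = 1) (g : ι → ℝ),
      mean (PMF.ofFintype w hw) g = ∑ i, (w i).toReal * g i := fun ι _ w hw g => tsum_fintype _
  have hlaw : ∀ g : Event r → ℝ, HasExp P.eventLaw g ∧ mean P.eventLaw g =
      ∑ i, P.pe i * g (.edges i) + (P.pv * g .vertex + P.pve * g .vertexEdges +
        (1 - (P.pv + P.pve + ∑ i, (P.pe i : ℝ))) * g .nothing) := fun g => by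
    have h1 := hasExp_map (p := PMF.ofFintype
      (fun o : Fin r ⊕ Fin 3 => ((Sum.elim P.pe
      ![P.pv, P.pve, 1 - (P.pv + P.pve + ∑ i, P.pe i)] o : ℝ≥0) : ℝ≥0∞)) (by
      rw [← ENNReal.ofNNReal_finsetSum, Fintype.sum_sum_type, Fin.sum_univ_three]
      simp only [Sum.elim_inl, Sum.elim_inr, Matrix.cons_val]
      rw [show ∀ a b c d : ℝ≥0, a + (b + c + d) = b + c + a + d by intros; ring,
        add_tsub_cancel_of_le P.p_le_one, ENNReal.coe_one]))
      (φ := Sum.elim Event.edges ![Event.vertex, Event.vertexEdges, Event.nothing]) (f := g)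
      (hfin _ _ _)
    refine ⟨h1.1, h1.2.trans ?_⟩
    rw [hmean, Fintype.sum_sum_type, Fin.sum_univ_three]
    simp only [Sum.elim_inl, Sum.elim_inr, Matrix.cons_val,
      ENNReal.coe_toReal, NNReal.coe_sub P.p_le_one, NNReal.coe_add, NNReal.coe_sum,
      NNReal.coe_one]
  obtain ⟨h1, h2⟩ := hasExp_bind_and_mean_bind (p := P.eventLaw) (q := P.eventStep t H) (f := f)
    (fun e _ => h e) (hlaw _).1
  rw [step_eq_bind]
  refine ⟨h1, h2.trans ((hlaw _).2.trans ?_)⟩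
  simp only [eventStep, mean_pure]

theorem hasExp_eventStep_of_bdd {t : ℕ} {H : MultiHypergraph} {f : MultiHypergraph → ℝ} {C : ℝ}
    (h : ∀ H', P.IsNext t H H' → |f H'| ≤ C) (e : Event r) : HasExp (P.eventStep t H e) f :=
  HasExp.of_bdd fun _ h' => h _ (isNext_of_mem_eventStep h')

open MultiHypergraph

variable {P} {μ₀ : ℝ} {μ : Fin r → ℝ}

/-- An additive quantity has constant drift. -/
theorem hasExp_step_of_isAdditive {f : MultiHypergraph → ℝ} {a b : ℝ} (hf : IsAdditive f a b)
    (hY : ∀ t, HasMean (P.Y t) μ₀) (hX : ∀ i t, HasMean (P.X i t) (μ i))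
    (t : ℕ) (H : MultiHypergraph) :
    HasExp (P.step t H) f ∧
      mean (P.step t H) f = f H + (a * P.Vbar + b * P.Dbar μ₀ μ) := by
  -- The new vertex supplies `m` incidences and the draws `m (y - 1)`, in all `m y`; `1 ≤ y` makes
  -- the subtraction exact.
  have hcY : ∀ y ∈ (P.Y t).support,
      ∀ es ∈ (draws (draws (H.chooseVertex P.γ) (y - 1)) P.m).support,
      f (H.addVertex es) = f H + a + b * P.m * y := fun y hy es hes => by
    rw [hf.addVertex, card_of_mem_support_draws hes, card_sum_of_mem_support_draws hes]
    push_cast [P.Y_pos t y hy]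
    ring
  have hcX : ∀ i, ∀ x ∈ (P.X i t).support,
      ∀ es ∈ (draws (draws (H.chooseVertex P.γ) x) P.m).support,
      f (H.addEdges es) = f H + b * P.m * x := fun i x hx es hes => by
    rw [hf.addEdges, card_sum_of_mem_support_draws hes]
    push_cast
    ring
  have keyY : HasExp (P.eventStep t H .vertexEdges) f ∧
      mean (P.eventStep t H .vertexEdges) f = f H + a + b * P.m * μ₀ := by
    -- Given `y`, `f` is deterministic. Total expectation needs both its mean and its mean absolute
    -- value: `g` is taken to be `id` and `abs`.
    have h1 : ∀ y ∈ (P.Y t).support, ∀ g : ℝ → ℝ, HasExp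
        ((draws (draws (H.chooseVertex P.γ) (y - 1)) P.m).map H.addVertex) (fun H => g (f H)) ∧
        mean ((draws (draws (H.chooseVertex P.γ) (y - 1)) P.m).map H.addVertex)
          (fun H => g (f H)) = g (f H + a + b * P.m * y) := fun y hy g => by
      have := hasExp_map (p := draws (draws (H.chooseVertex P.γ) (y - 1)) P.m)
        (φ := H.addVertex) (f := fun H => g (f H))
        ((HasExp.const _ (g (f H + a + b * P.m * y))).congr fun es hes => by
          rw [hcY y hy es hes])
      exact ⟨this.1, this.2.trans ((mean_congr fun es hes => by
        rw [hcY y hy es hes]).trans (mean_const _ _))⟩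
    have h3 : HasExp (P.Y t) fun y => f H + a + b * P.m * y :=
      (HasExp.const _ _).add ((hY t).hasExp.const_mul _)
    have h2 := hasExp_bind_and_mean_bind (p := P.Y t) (f := f)
      (fun y hy => (h1 y hy id).1) (h3.abs.congr fun y hy => ((h1 y hy abs).2).symm)
    refine ⟨h2.1, h2.2.trans ((mean_congr fun y hy => (h1 y hy id).2).trans ?_)⟩
    simp only [id]
    rw [mean_add (HasExp.const _ _) ((hY t).hasExp.const_mul _), mean_const, mean_const_mul,
      (hY t).mean_eq]
  have keyX : ∀ i, HasExp (P.eventStep t H (.edges i)) f ∧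
      mean (P.eventStep t H (.edges i)) f = f H + b * P.m * μ i := fun i => by
    have h1 : ∀ y ∈ (P.X i t).support, ∀ g : ℝ → ℝ, HasExp
        ((draws (draws (H.chooseVertex P.γ) y) P.m).map H.addEdges) (fun H => g (f H)) ∧
        mean ((draws (draws (H.chooseVertex P.γ) y) P.m).map H.addEdges)
          (fun H => g (f H)) = g (f H + b * P.m * y) := fun y hy g => by
      have := hasExp_map (p := draws (draws (H.chooseVertex P.γ) y) P.m)
        (φ := H.addEdges) (f := fun H => g (f H))
        ((HasExp.const _ (g (f H + b * P.m * y))).congr fun es hes => by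
          rw [hcX i y hy es hes])
      exact ⟨this.1, this.2.trans ((mean_congr fun es hes => by
        rw [hcX i y hy es hes]).trans (mean_const _ _))⟩
    have h3 : HasExp (P.X i t) fun y => f H + b * P.m * y :=
      (HasExp.const _ _).add ((hX i t).hasExp.const_mul _)
    have h2 := hasExp_bind_and_mean_bind (p := P.X i t) (f := f)
      (fun y hy => (h1 y hy id).1) (h3.abs.congr fun y hy => ((h1 y hy abs).2).symm)
    refine ⟨h2.1, h2.2.trans ((mean_congr fun y hy => (h1 y hy id).2).trans ?_)⟩
    simp only [id]
    rw [mean_add (HasExp.const _ _) ((hX i t).hasExp.const_mul _), mean_const, mean_const_mul,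
      (hX i t).mean_eq]
  obtain ⟨h1, h2⟩ := P.hasExp_step (t := t) (H := H) (f := f) fun e => by
    cases e with
    | vertex => exact HasExp.pure _ _
    | vertexEdges => exact keyY.1
    | edges i => exact (keyX i).1
    | nothing => exact HasExp.pure _ _
  refine ⟨h1, h2.trans ?_⟩
  simp only [keyY.2, (keyX _).2, hf.addVertex, Vbar, Dbar]
  have e : ∑ i, (P.pe i : ℝ) * (f H + b * P.m * μ i) =
      f H * ∑ i, (P.pe i : ℝ) + b * P.m * ∑ i, P.pe i * μ i := by
    rw [Finset.mul_sum, Finset.mul_sum, ← Finset.sum_add_distrib]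
    exact Finset.sum_congr rfl fun i _ => by ring
  rw [e]
  simp
  ring

/-- An event with cardinality `y` creates exactly `m y` incidences, with or without a new vertex, so
one bound fits every kind of event. -/
theorem le_and_le_of_isNext {f : MultiHypergraph → ℝ} {a b c : ℝ} (hf : IsAdditive f a b)
    (ha : 0 ≤ a) (hb : 0 ≤ b) (hc : 0 ≤ c) {t : ℕ} {H H' : MultiHypergraph}
    (hY : ∀ y ∈ (P.Y t).support, (y : ℝ) ≤ c) (hX : ∀ i, ∀ x ∈ (P.X i t).support, (x : ℝ) ≤ c)
    (h : P.IsNext t H H') : f H ≤ f H' ∧ f H' ≤ f H + (a + b * (P.m * c)) := by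
  have hbm : 0 ≤ b * (P.m * c) := by positivity
  cases h with
  | vertex => rw [hf.addVertex]; simp; exact ⟨ha, hbm⟩
  | vertexEdges y hy es hes hsum =>
    rw [hf.addVertex, hes, hsum]
    have h1 := P.Y_pos t y hy
    have h2 : (P.m : ℝ) + (P.m * (y - 1) : ℕ) = P.m * y := by push_cast [h1]; ring
    have h3 : b * (P.m * y) ≤ b * (P.m * c) := by gcongr; exact hY y hy
    have h4 : 0 ≤ b * (P.m * (y : ℝ)) := by positivity
    rw [h2]
    constructor <;> linarith
  | edges i x hx es hsum =>
    rw [hf.addEdges, hsum]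
    have h3 : b * (P.m * x) ≤ b * (P.m * c) := by gcongr; exact hX i x hx
    have h4 : 0 ≤ b * (P.m * (x : ℝ)) := by positivity
    push_cast
    constructor <;> linarith
  | nothing => constructor <;> linarith

theorem order_le_of_isNext {t : ℕ} {H H' : MultiHypergraph} (h : P.IsNext t H H') :
    (H'.order : ℝ) ≤ H.order + 1 := by
  cases h <;> simp [addVertex, addEdges]

theorem mean_draws_comp_sum (H : MultiHypergraph) (n : ℕ) {F : Multiset (Fin H.order) → ℝ} {C : ℝ}
    (hF : ∀ s, |F s| ≤ C) :
    (mean (draws (draws (H.chooseVertex P.γ) n) P.m) fun es => F es.sum) =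
      mean (draws (H.chooseVertex P.γ) (P.m * n)) F := by
  rw [← map_sum_draws, (hasExp_map (HasExp.of_bdd fun _ _ => hF _)).2]

/-- The expected number of new vertices of degree `k` in one step. -/
noncomputable def source (P : Model r) (k : ℕ) : ℝ :=
  (if k = 0 then (P.pv : ℝ) else 0) + if k = P.m then (P.pve : ℝ) else 0

/-- The expected increase of the number of vertices of degree `k`, up to an error due to vertices
that are chosen repeatedly. -/
theorem abs_mean_step_numDegree_sub_le
    (hY : ∀ t, HasMean (P.Y t) μ₀) (hX : ∀ i t, HasMean (P.X i t) (μ i))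
    {t : ℕ} {H : MultiHypergraph} (hW : H.weight P.γ ≠ 0) {c : ℝ} (hc : 0 ≤ c)
    (hYc : ∀ y ∈ (P.Y t).support, (y : ℝ) ≤ c) (hXc : ∀ i, ∀ x ∈ (P.X i t).support, (x : ℝ) ≤ c)
    (k : ℕ) :
    |mean (P.step t H) (fun H' => (H'.numDegree k : ℝ)) -
      (H.numDegree k + P.source k + (P.Dbar μ₀ μ - P.m * P.pve) *
        ((H.prevWeight P.γ k - (k + P.γ) * H.numDegree k) / H.weight P.γ))| ≤
      2 * (P.m * c) * min 1 (P.m * c * ((k + P.γ) / H.weight P.γ)) := by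
  set Δ := (H.prevWeight P.γ k - (k + P.γ) * H.numDegree k) / H.weight P.γ with hΔ
  set E := 2 * (P.m * c) * min 1 (P.m * c * ((k + P.γ) / H.weight P.γ)) with hE
  have hE0 : 0 ≤ E := by positivity
  set F : Multiset (Fin H.order) → ℝ := fun s =>
    ∑ v : Fin H.order, if H.degree v + s.count v = k then (1 : ℝ) else 0 with hF
  have hFb : ∀ s, |F s| ≤ H.order := fun s => by
    rw [hF, abs_of_nonneg (Finset.sum_nonneg fun v _ => by split_ifs <;> norm_num)]
    refine (Finset.sum_le_card_nsmul _ _ 1 fun v _ => by split_ifs <;> norm_num).trans ?_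
    simp
  have hN : ∀ H', P.IsNext t H H' → |(H'.numDegree k : ℝ)| ≤ H.order + 1 := fun H' h' => by
    rw [abs_of_nonneg (Nat.cast_nonneg _)]
    exact (Nat.cast_le.2 (H'.numDegree_le k)).trans (order_le_of_isNext h')
  -- To first order the expected count is affine in `n`, with an error uniform over `n ≤ c`.
  -- Averaging over the random cardinality therefore involves only its mean.
  have hT : ∀ n : ℕ, (n : ℝ) ≤ c → |mean (draws (H.chooseVertex P.γ) (P.m * n)) F -
      (H.numDegree k + P.m * Δ * n)| ≤ E := fun n hn => by
    have h1 := H.abs_mean_draws_sum_sub_le hW k (P.m * n)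
    rw [← hΔ] at h1
    push_cast at h1
    rw [show (P.m : ℝ) * n * Δ = P.m * Δ * n by ring] at h1
    refine h1.trans ?_
    rw [hE]
    gcongr
  have hbd : ∀ n : ℕ, |mean (draws (H.chooseVertex P.γ) n) F| ≤ H.order := fun n =>
    abs_mean_le_of_abs_le fun s _ => hFb s
  have keyX : ∀ i, |mean (P.eventStep t H (.edges i)) (fun H' => (H'.numDegree k : ℝ)) -
      (H.numDegree k + P.m * Δ * μ i)| ≤ E := fun i => by
    have e : mean (P.eventStep t H (.edges i)) (fun H' => (H'.numDegree k : ℝ)) =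
        mean (P.X i t) fun x => mean (draws (H.chooseVertex P.γ) (P.m * x)) F := by
      rw [eventStep, mean_bind_of_bdd fun x hx H' h' =>
        hN H' (isNext_of_mem_eventStep (e := .edges i)
          ((PMF.mem_support_bind_iff _ _ _).2 ⟨x, hx, h'⟩))]
      refine mean_congr fun x hx => ?_
      have hcongr : ∀ es, ((H.addEdges es).numDegree k : ℝ) = F es.sum := fun es => by
        rw [coe_numDegree, H.sum_range_addEdges es fun d => if d = k then (1 : ℝ) else 0]
      rw [(hasExp_map (φ := H.addEdges) (f := fun H' => (H'.numDegree k : ℝ))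
        (HasExp.of_bdd (C := H.order) fun es _ => by rw [hcongr]; exact hFb _)).2]
      simp only [hcongr]
      exact mean_draws_comp_sum H x hFb
    have hm : HasExp (P.X i t) fun x => H.numDegree k + P.m * Δ * x :=
      (HasExp.const _ _).add ((hX i t).hasExp.const_mul _)
    have h3 := abs_mean_sub_mean_le (HasExp.of_bdd fun x _ => hbd (P.m * x)) hm
      (HasExp.const _ E) fun x hx => hT x (hXc i x hx)
    rwa [mean_const, mean_add (HasExp.const _ _) ((hX i t).hasExp.const_mul _), mean_const,
      mean_const_mul, (hX i t).mean_eq, ← e] at h3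
  have keyY : |mean (P.eventStep t H .vertexEdges) (fun H' => (H'.numDegree k : ℝ)) -
      (H.numDegree k + P.m * Δ * (μ₀ - 1) + if k = P.m then 1 else 0)| ≤ E := by
    have e : mean (P.eventStep t H .vertexEdges) (fun H' => (H'.numDegree k : ℝ)) =
        mean (P.Y t) fun y => mean (draws (H.chooseVertex P.γ) (P.m * (y - 1))) F +
          if k = P.m then 1 else 0 := by
      rw [eventStep, mean_bind_of_bdd fun x hx H' h' =>
        hN H' (isNext_of_mem_eventStep (e := .vertexEdges)
          ((PMF.mem_support_bind_iff _ _ _).2 ⟨x, hx, h'⟩))]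
      refine mean_congr fun y hy => ?_
      have hcongr : ∀ es, ((H.addVertex es).numDegree k : ℝ) =
          F es.sum + if es.card = k then (1 : ℝ) else 0 := fun es => by
        rw [coe_numDegree, H.sum_range_addVertex es fun d => if d = k then (1 : ℝ) else 0]
      have hFm : HasExp (draws (draws (H.chooseVertex P.γ) (y - 1)) P.m) fun es => F es.sum :=
        HasExp.of_bdd fun es _ => hFb _
      have hcongr' : ∀ es ∈ (draws (draws (H.chooseVertex P.γ) (y - 1)) P.m).support,
          ((H.addVertex es).numDegree k : ℝ) = F es.sum + if k = P.m then 1 else 0 :=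
        fun es hes => by
          rw [hcongr, card_of_mem_support_draws hes]
          simp only [eq_comm]
      rw [(hasExp_map (φ := H.addVertex) (f := fun H' => (H'.numDegree k : ℝ))
        ((hFm.add (HasExp.const _ _)).congr fun es hes => (hcongr' es hes).symm)).2,
        mean_congr hcongr', mean_add hFm (HasExp.const _ _), mean_const]
      rw [mean_draws_comp_sum H (y - 1) hFb]
    -- The new vertex occupies one place in each hyperedge, so only `y - 1` vertices are drawn. This
    -- is the origin of `- m p_ve` in the drift.
    have hm : HasExp (P.Y t) fun y => (H.numDegree k - P.m * Δ) + P.m * Δ * y :=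
      (HasExp.const _ _).add ((hY t).hasExp.const_mul _)
    have hTm : HasExp (P.Y t) fun y => mean (draws (H.chooseVertex P.γ) (P.m * (y - 1))) F :=
      HasExp.of_bdd fun x _ => hbd (P.m * (x - 1))
    have h3 := abs_mean_sub_mean_le hTm hm (HasExp.const _ E) fun y hy => by
      have h1 := P.Y_pos t y hy
      have h2 := hT (y - 1) (by push_cast [h1]; linarith [hYc y hy])
      push_cast [h1] at h2
      convert h2 using 3
      ring
    rw [mean_const, mean_add (HasExp.const _ _) ((hY t).hasExp.const_mul _), mean_const,
      mean_const_mul, (hY t).mean_eq] at h3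
    rw [e, mean_add hTm (HasExp.const _ _), mean_const]
    convert h3 using 2
    ring
  rw [(P.hasExp_step (P.hasExp_eventStep_of_bdd hN)).2]
  have hv : ((H.addVertex 0).numDegree k : ℝ) = H.numDegree k + if k = 0 then 1 else 0 := by
    rw [coe_numDegree, H.sum_range_addVertex 0 fun d => if d = k then (1 : ℝ) else 0,
      coe_numDegree, H.sum_range_degree fun d => if d = k then (1 : ℝ) else 0]
    simp [eq_comm]
  rw [hv]
  generalize (mean (P.eventStep t H .vertexEdges) fun H' => (H'.numDegree k : ℝ)) = A at *
  generalize hB : (fun i => mean (P.eventStep t H (.edges i)) fun H' => (H'.numDegree k : ℝ)) = B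
  replace keyX : ∀ i, |B i - (H.numDegree k + P.m * Δ * μ i)| ≤ E := fun i => by
    rw [← hB]; exact keyX i
  simp only [show ∀ i, (mean (P.eventStep t H (.edges i)) fun H' => (H'.numDegree k : ℝ)) = B i from
    fun i => by rw [← hB]]
  generalize (H.numDegree k : ℝ) = N at *
  -- Isolated vertices and idle steps are accounted for exactly; the other errors carry weights of
  -- sum at most `1`.
  have e : ∑ i, (P.pe i : ℝ) * B i + (P.pv * (N + if k = 0 then 1 else 0) + P.pve * A +
      (1 - (P.pv + P.pve + ∑ i, (P.pe i : ℝ))) * N) -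
      (N + P.source k + (P.Dbar μ₀ μ - P.m * P.pve) * Δ) =
      P.pve * (A - (N + P.m * Δ * (μ₀ - 1) + if k = P.m then 1 else 0)) +
        ∑ i, (P.pe i : ℝ) * (B i - (N + P.m * Δ * μ i)) := by
    have e1 : ∑ i, (P.pe i : ℝ) * (B i - (N + P.m * Δ * μ i)) =
        ∑ i, (P.pe i : ℝ) * B i - N * ∑ i, (P.pe i : ℝ) - P.m * Δ * ∑ i, P.pe i * μ i := by
      rw [Finset.mul_sum, Finset.mul_sum, ← Finset.sum_sub_distrib, ← Finset.sum_sub_distrib]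
      exact Finset.sum_congr rfl fun i _ => by ring
    rw [e1, source, Dbar]
    split_ifs <;> ring
  rw [e]
  refine (abs_add_le _ _).trans ?_
  have hp : (P.pve : ℝ) + ∑ i, (P.pe i : ℝ) ≤ 1 := by
    have h1 : ((P.pv + P.pve + ∑ i, P.pe i : ℝ≥0) : ℝ) ≤ 1 := by exact_mod_cast P.p_le_one
    push_cast at h1
    linarith [P.pv.coe_nonneg]
  have b1 : |(P.pve : ℝ) * (A - (N + P.m * Δ * (μ₀ - 1) + if k = P.m then 1 else 0))| ≤
      P.pve * E := by
    rw [abs_mul, abs_of_nonneg P.pve.coe_nonneg]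
    exact mul_le_mul_of_nonneg_left keyY P.pve.coe_nonneg
  have b2 : |∑ i, (P.pe i : ℝ) * (B i - (N + P.m * Δ * μ i))| ≤ (∑ i, (P.pe i : ℝ)) * E := by
    rw [Finset.sum_mul]
    refine (Finset.abs_sum_le_sum_abs _ _).trans (Finset.sum_le_sum fun i _ => ?_)
    rw [abs_mul, abs_of_nonneg (P.pe i).coe_nonneg]
    exact mul_le_mul_of_nonneg_left (keyX i) (P.pe i).coe_nonneg
  nlinarith

end Model

end PrefAttach

namespace PrefAttach

/-! ### Asymptotics of recursively defined sequences -/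

/-- If `|u (s + 1)| ≤ |u s| + o(1)` then `u s = o(s)`. -/
theorem tendsto_div_zero_of_abs_succ_le {u e : ℕ → ℝ} {s₀ : ℕ} (he : Tendsto e atTop (𝓝 0))
    (h : ∀ s, s₀ ≤ s → |u (s + 1)| ≤ |u s| + |e s|) :
    Tendsto (fun s : ℕ => u s / s) atTop (𝓝 0) := by
  have hbound : ∀ s, s₀ ≤ s → |u s| ≤ |u s₀| + ∑ i ∈ Finset.range s, |e i| := fun s hs => by
    induction s, hs using Nat.le_induction with
    | base => linarith [Finset.sum_nonneg fun i (_ : i ∈ Finset.range s₀) => abs_nonneg (e i)]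
    | succ s hs ih =>
      rw [Finset.sum_range_succ]
      linarith [h s hs]
  have habs : Tendsto (fun s => |e s|) atTop (𝓝 0) := by simpa using he.abs
  have hlim : Tendsto (fun s : ℕ => |u s₀| / s + (s : ℝ)⁻¹ * ∑ i ∈ Finset.range s, |e i|)
      atTop (𝓝 (0 + 0)) :=
    (tendsto_const_div_atTop_nhds_zero_nat _).add habs.cesaro
  rw [add_zero] at hlim
  refine squeeze_zero_norm' ?_ hlim
  filter_upwards [eventually_ge_atTop s₀] with s hs
  rw [Real.norm_eq_abs, abs_div, Nat.abs_cast, inv_mul_eq_div, ← add_div]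
  exact div_le_div_of_nonneg_right (hbound s hs) (Nat.cast_nonneg s)

/-- If `a (s + 1) = (1 - b / s) a s + c + o(1)` then `a s / s` converges to `c / (1 + b)`. -/
theorem tendsto_div_of_recursion {a : ℕ → ℝ} {b c : ℝ} (hb : 0 ≤ b)
    (h : Tendsto (fun s : ℕ => a (s + 1) - (1 - b / s) * a s) atTop (𝓝 c)) :
    Tendsto (fun s : ℕ => a s / s) atTop (𝓝 (c / (1 + b))) := by
  have hb1 : 1 + b ≠ 0 := by positivity
  set d := c / (1 + b) with hd
  have hdc : d * (1 + b) = c := div_mul_cancel₀ _ hb1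
  -- The line `d * s` solves the recursion exactly, since `d + d * b = c`; only the deviation from
  -- it remains.
  set u : ℕ → ℝ := fun s => a s - d * s with hu
  have he : Tendsto (fun s : ℕ => u (s + 1) - (1 - b / s) * u s) atTop (𝓝 0) := by
    have h' := h.sub_const c
    rw [sub_self] at h'
    refine h'.congr' ?_
    filter_upwards [eventually_ge_atTop 1] with s hs
    have : (s : ℝ) ≠ 0 := by positivity
    simp only [hu, ← hdc]
    push_cast
    field_simp
    ring
  have hu0 : Tendsto (fun s : ℕ => u s / s) atTop (𝓝 0) := by
    -- For `s ≥ b` the factor `1 - b / s` lies in `[0, 1]`, so `|u|` grows by at most the error.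
    refine tendsto_div_zero_of_abs_succ_le (s₀ := max 1 ⌈b⌉₊) he fun s hs => ?_
    have hs1 : (1 : ℝ) ≤ s := by exact_mod_cast (le_max_left _ _).trans hs
    have hsb : b ≤ s := (Nat.le_ceil b).trans (by exact_mod_cast (le_max_right _ _).trans hs)
    have h1 : 0 ≤ b / s := by positivity
    have h2 : b / s ≤ 1 := (div_le_one (by linarith)).2 hsb
    have h3 : |(1 - b / s) * u s| ≤ |u s| := by
      rw [abs_mul, abs_of_nonneg (by linarith : 0 ≤ 1 - b / s)]
      exact mul_le_of_le_one_left (abs_nonneg _) (by linarith)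
    have h4 := abs_add_le ((1 - b / s) * u s) (u (s + 1) - (1 - b / s) * u s)
    rw [add_sub_cancel] at h4
    linarith
  have h5 := hu0.add_const d
  rw [zero_add] at h5
  refine h5.congr' ?_
  filter_upwards [eventually_ge_atTop 1] with s hs
  have : (s : ℝ) ≠ 0 := by positivity
  simp only [hu]
  field_simp
  ring

/-- Chebyshev without probabilities: if `W ≥ ws / 2` the quotient is at most `2x / ws`; otherwise
`(W - ws)² ≥ ws² / 4` and the last term exceeds `1`. It trades a random denominator for a second
moment. -/
theorem min_one_le {W x ws : ℝ} (hx : 0 ≤ x) (hws : 0 < ws) :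
    min 1 (x / W) ≤ 2 * x / ws + 4 * ((W - ws) ^ 2 / ws ^ 2) := by
  by_cases h : ws / 2 ≤ W
  · have h1 : x / W ≤ x / (ws / 2) := by gcongr
    have h2 : x / (ws / 2) = 2 * x / ws := by field_simp
    have : 0 ≤ 4 * ((W - ws) ^ 2 / ws ^ 2) := by positivity
    linarith [min_le_right 1 (x / W)]
  · have h1 : 1 ≤ 4 * ((W - ws) ^ 2 / ws ^ 2) := by
      rw [← mul_div_assoc, one_le_div (by positivity)]
      nlinarith
    have : 0 ≤ 2 * x / ws := by positivity
    linarith [min_le_left 1 (x / W)]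

namespace Model

open MultiHypergraph

variable {r : ℕ} (P : Model r)

/-! ### The process restarted at a given time -/

/-- The distribution of `H_{t₀ + s}` given `H_{t₀} = H`. -/
noncomputable def run (t₀ : ℕ) (H : MultiHypergraph) : ℕ → PMF MultiHypergraph
  | 0 => PMF.pure H
  | s + 1 => (run t₀ H s).bind (P.step (t₀ + s))

theorem law_add (t₀ s : ℕ) : P.law (t₀ + s) = (P.law t₀).bind fun H => P.run t₀ H s := by
  induction s with
  | zero => exact (PMF.bind_pure _).symm
  | succ s ih =>
    rw [← add_assoc, law, ih, PMF.bind_bind]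
    rfl

/-- From time `t₀` on, the cardinalities of the hyperedges added at time `t₀ + s` are at most
`c s = o(s ^ (1 / 3))`. -/
structure GrowthBound (t₀ : ℕ) (c : ℕ → ℝ) : Prop where
  one_le : ∀ s, 1 ≤ c s
  mono : Monotone c
  Y_le : ∀ s, ∀ y ∈ (P.Y (t₀ + s)).support, (y : ℝ) ≤ c s
  X_le : ∀ s i, ∀ x ∈ (P.X i (t₀ + s)).support, (x : ℝ) ≤ c s
  tendsto : Tendsto (fun s : ℕ => c s ^ 3 / s) atTop (𝓝 0)

variable {P} {μ₀ : ℝ} {μ : Fin r → ℝ} {t₀ : ℕ} {c : ℕ → ℝ}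

theorem GrowthBound.tendsto_pow (hc : P.GrowthBound t₀ c) {j : ℕ} (hj : j ≤ 3) :
    Tendsto (fun s : ℕ => c s ^ j / s) atTop (𝓝 0) :=
  squeeze_zero (fun s => div_nonneg (pow_nonneg (zero_le_one.trans (hc.one_le s)) _)
    (Nat.cast_nonneg s)) (fun s => div_le_div_of_nonneg_right (pow_le_pow_right₀ (hc.one_le s) hj)
    (Nat.cast_nonneg s)) hc.tendsto

theorem le_and_le_of_mem_run (hc : P.GrowthBound t₀ c) {f : MultiHypergraph → ℝ} {a b : ℝ}
    (hf : IsAdditive f a b) (ha : 0 ≤ a) (hb : 0 ≤ b) {H H' : MultiHypergraph} {s : ℕ}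
    (h : H' ∈ (P.run t₀ H s).support) :
    f H ≤ f H' ∧ f H' ≤ f H + s * (a + b * (P.m * c s)) := by
  induction s generalizing H' with
  | zero =>
    rw [run, PMF.support_pure, Set.mem_singleton_iff] at h
    simp [h]
  | succ s ih =>
    rw [run, PMF.mem_support_bind_iff] at h
    obtain ⟨H₁, h₁, h⟩ := h
    obtain ⟨i1, i2⟩ := ih h₁
    have hc0 : 0 ≤ c s := zero_le_one.trans (hc.one_le s)
    obtain ⟨j1, j2⟩ := le_and_le_of_isNext hf ha hb hc0 (hc.Y_le s) (hc.X_le s)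
      (isNext_of_mem_step h)
    have hm : b * (P.m * c s) ≤ b * (P.m * c (s + 1)) := by
      gcongr
      exact hc.mono (Nat.le_succ s)
    refine ⟨i1.trans j1, ?_⟩
    have hs : (0 : ℝ) ≤ s := Nat.cast_nonneg s
    push_cast
    nlinarith

theorem abs_le_of_mem_run (hc : P.GrowthBound t₀ c) {f : MultiHypergraph → ℝ} {a b : ℝ}
    (hf : IsAdditive f a b) (ha : 0 ≤ a) (hb : 0 ≤ b) (H : MultiHypergraph) (s : ℕ) :
    ∀ H' ∈ (P.run t₀ H s).support, |f H'| ≤ |f H| + s * (a + b * (P.m * c s)) := fun H' h => by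
  obtain ⟨h1, h2⟩ := le_and_le_of_mem_run hc hf ha hb h
  have hc0 : 0 ≤ c s := zero_le_one.trans (hc.one_le s)
  have h3 : 0 ≤ (s : ℝ) * (a + b * (P.m * c s)) := by positivity
  have h4 := neg_abs_le (f H)
  have h5 := le_abs_self (f H)
  rw [abs_le]
  constructor <;> linarith

/-- The second moment of the deviation of an additive quantity from its linear growth. -/
theorem mean_run_sq_le (hc : P.GrowthBound t₀ c) {f : MultiHypergraph → ℝ} {a b : ℝ}
    (hf : IsAdditive f a b) (ha : 0 ≤ a) (hb : 0 ≤ b)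
    (hY : ∀ t, HasMean (P.Y t) μ₀) (hX : ∀ i t, HasMean (P.X i t) (μ i))
    (H : MultiHypergraph) (s : ℕ) :
    (mean (P.run t₀ H s) fun H' => (f H' - (a * P.Vbar + b * P.Dbar μ₀ μ) * s) ^ 2) ≤
      f H ^ 2 + s * (a + b * (P.m * c s)) ^ 2 := by
  induction s with
  | zero => simp [run, mean_pure]
  | succ s ih =>
    have hc0 : 0 ≤ c s := zero_le_one.trans (hc.one_le s)
    have h1 := mean_sq_bind_le (p := P.run t₀ H s) (q := P.step (t₀ + s)) (Z := f)
      (z := a * P.Vbar + b * P.Dbar μ₀ μ) (B := a + b * (P.m * c s))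
      ((a * P.Vbar + b * P.Dbar μ₀ μ) * s) (abs_le_of_mem_run hc hf ha hb H s)
      (fun H₁ _ H₂ h₂ => by
        obtain ⟨j1, j2⟩ := le_and_le_of_isNext hf ha hb hc0 (hc.Y_le s) (hc.X_le s)
          (isNext_of_mem_step h₂)
        rw [abs_of_nonneg (sub_nonneg.2 j1)]
        linarith)
      fun H₁ _ => (hasExp_step_of_isAdditive hf hY hX _ _).2
    have hm : (a + b * (P.m * c s)) ^ 2 ≤ (a + b * (P.m * c (s + 1))) ^ 2 := by
      gcongr
      exact hc.mono (Nat.le_succ s)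
    have hs : (0 : ℝ) ≤ s := Nat.cast_nonneg s
    rw [run]
    push_cast
    rw [mul_add_one (a * P.Vbar + b * P.Dbar μ₀ μ)]
    nlinarith

/-! ### The averaged recursion for the degree counts -/

theorem prevWeight_nonneg (H : MultiHypergraph) (γ : ℝ≥0) (k : ℕ) : 0 ≤ H.prevWeight γ k :=
  Finset.sum_nonneg fun v _ => by split_ifs <;> positivity

theorem prevWeight_le (H : MultiHypergraph) (γ : ℝ≥0) (k : ℕ) : H.prevWeight γ k ≤ H.weight γ := by
  cases k with
  | zero => rw [prevWeight_zero]; positivity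
  | succ k => rw [prevWeight_succ]; exact H.mul_numDegree_le_weight γ k

/-- The asymptotic growth rate of the normalising weight. -/
noncomputable def weightRate (P : Model r) (μ₀ : ℝ) (μ : Fin r → ℝ) : ℝ :=
  P.γ * P.Vbar + P.Dbar μ₀ μ

/-- The ratio of the rate at which vertices are chosen and the growth rate of the weight. -/
noncomputable def rate (P : Model r) (μ₀ : ℝ) (μ : Fin r → ℝ) : ℝ :=
  (P.Dbar μ₀ μ - P.m * P.pve) / P.weightRate μ₀ μ

/-- A bound for the second moment of the deviation of the weight from its linear growth. -/
noncomputable def weightVar (P : Model r) (c : ℕ → ℝ) (H : MultiHypergraph) (s : ℕ) : ℝ :=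
  H.weight P.γ ^ 2 + s * (P.γ + P.m * c s) ^ 2

/-- The error in the recursion for the expected number of vertices of degree `k`. -/
noncomputable def recursionError (P : Model r) (μ₀ : ℝ) (μ : Fin r → ℝ) (c : ℕ → ℝ)
    (H : MultiHypergraph) (k s : ℕ) : ℝ :=
  (P.Dbar μ₀ μ - P.m * P.pve) * (√(P.weightVar c H s) / (P.weightRate μ₀ μ * s)) +
    2 * (P.m * c s) * (2 * (P.m * c s * (k + P.γ)) / (P.weightRate μ₀ μ * s) +
      4 * (P.weightVar c H s / (P.weightRate μ₀ μ * s) ^ 2))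

/-- The variance bound is of order `s c²`, leaving `c^(j + 2) / s`; the case `j = 1` requires `c³ =
o(s)`. -/
theorem tendsto_weightVar_div (hc : P.GrowthBound t₀ c) (H : MultiHypergraph) {j : ℕ} (hj : j ≤ 1) :
    Tendsto (fun s : ℕ => c s ^ j * P.weightVar c H s / (s : ℝ) ^ 2) atTop (𝓝 0) := by
  have h1 : Tendsto (fun s : ℕ => (1 : ℝ) / s) atTop (𝓝 0) := tendsto_one_div_atTop_nhds_zero_nat
  have h2 := ((((hc.tendsto_pow (j := j) (by omega)).mul h1).const_mul ((H.weight P.γ : ℝ) ^ 2)).add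
    ((hc.tendsto_pow (j := j) (by omega)).const_mul ((P.γ : ℝ) ^ 2))).add
    (((hc.tendsto_pow (j := j + 1) (by omega)).const_mul (2 * P.γ * P.m : ℝ)).add
    ((hc.tendsto_pow (j := j + 2) (by omega)).const_mul ((P.m : ℝ) ^ 2)))
  simp only [mul_zero, add_zero] at h2
  refine h2.congr' ?_
  filter_upwards [eventually_ge_atTop 1] with s hs
  have : (s : ℝ) ≠ 0 := by positivity
  rw [weightVar]
  field_simp
  ring

/-- The three terms are the cost of replacing `W` by `w s` in the drift (`√Var / s`), repeated hits
at typical weight (`c² / s`), and atypically small weight (`c Var / s²`). -/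
theorem tendsto_recursionError (hc : P.GrowthBound t₀ c) (H : MultiHypergraph) (k : ℕ) :
    Tendsto (P.recursionError μ₀ μ c H k) atTop (𝓝 0) := by
  have h0 : Tendsto (fun s : ℕ => √(P.weightVar c H s) / s) atTop (𝓝 0) := by
    have h := (tendsto_weightVar_div hc H zero_le_one).sqrt
    rw [Real.sqrt_zero] at h
    refine h.congr fun s => ?_
    rw [pow_zero, one_mul, Real.sqrt_div' _ (by positivity), Real.sqrt_sq (Nat.cast_nonneg s)]
  have h := ((h0.const_mul ((P.Dbar μ₀ μ - P.m * P.pve) / P.weightRate μ₀ μ)).add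
    ((hc.tendsto_pow (j := 2) (by omega)).const_mul
      (4 * P.m ^ 2 * (k + P.γ) / P.weightRate μ₀ μ))).add
    ((tendsto_weightVar_div hc H le_rfl).const_mul (8 * P.m / P.weightRate μ₀ μ ^ 2))
  simp only [mul_zero, add_zero] at h
  refine h.congr fun s => ?_
  rw [recursionError]
  simp only [div_eq_mul_inv, mul_inv, mul_pow, pow_one]
  ring

theorem weight_le_of_mem_run (hc : P.GrowthBound t₀ c) {H H' : MultiHypergraph} {s : ℕ}
    (h : H' ∈ (P.run t₀ H s).support) : H.weight P.γ ≤ H'.weight P.γ := by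
  have := (le_and_le_of_mem_run hc (isAdditive_weight P.γ) P.γ.coe_nonneg zero_le_one h).1
  exact_mod_cast this

theorem abs_mean_run_succ_numDegree_sub_le (hc : P.GrowthBound t₀ c)
    (hY : ∀ t, HasMean (P.Y t) μ₀) (hX : ∀ i t, HasMean (P.X i t) (μ i))
    (hD : 0 ≤ P.Dbar μ₀ μ - P.m * P.pve) (hw : 0 < P.weightRate μ₀ μ)
    {H : MultiHypergraph} (hH : 0 < H.weight P.γ) (k : ℕ) {s : ℕ} (hs : s ≠ 0) :
    |mean (P.run t₀ H (s + 1)) (fun H' => (H'.numDegree k : ℝ)) -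
      (mean (P.run t₀ H s) (fun H' => (H'.numDegree k : ℝ)) + P.source k + P.rate μ₀ μ *
        ((mean (P.run t₀ H s) (fun H' => H'.prevWeight P.γ k) -
          (k + P.γ) * mean (P.run t₀ H s) (fun H' => (H'.numDegree k : ℝ))) / s))| ≤
      P.recursionError μ₀ μ c H k s := by
  have hs0 : (0 : ℝ) < s := by positivity
  set p := P.run t₀ H s with hp
  set w := P.weightRate μ₀ μ with hwdef
  set l := P.Dbar μ₀ μ - P.m * P.pve with hl
  have hc0 : 0 ≤ c s := zero_le_one.trans (hc.one_le s)
  have hws : 0 < w * s := by positivity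
  -- boundedness
  have bW := abs_le_of_mem_run hc (isAdditive_weight P.γ) P.γ.coe_nonneg zero_le_one H s
  have bO := abs_le_of_mem_run hc isAdditive_order zero_le_one le_rfl H s
  set CO := |(H.order : ℝ)| + s * (1 + 0 * (P.m * c s)) with hCO
  have bN : ∀ H' ∈ p.support, |(H'.numDegree k : ℝ)| ≤ CO := fun H' h' => by
    refine le_trans ?_ (bO H' h')
    simp only [Nat.abs_cast]
    exact_mod_cast H'.numDegree_le k
  have iW : HasExp p fun H' => (H'.weight P.γ : ℝ) := HasExp.of_bdd bW
  have iN : HasExp p fun H' => (H'.numDegree k : ℝ) := HasExp.of_bdd bN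
  have iA : HasExp p fun H' => H'.prevWeight P.γ k := HasExp.of_bdd fun H' h' => by
    rw [abs_of_nonneg (prevWeight_nonneg _ _ _)]
    exact (prevWeight_le _ _ _).trans ((le_abs_self _).trans (bW H' h'))
  have iD : HasExp p fun H' => (H'.weight P.γ : ℝ) - w * s := iW.sub (HasExp.const _ _)
  have iS : HasExp p fun H' => ((H'.weight P.γ : ℝ) - w * s) ^ 2 := HasExp.of_bdd fun H' h' => by
    rw [abs_pow]
    exact pow_le_pow_left₀ (abs_nonneg _) ((abs_sub _ _).trans (add_le_add_left (bW H' h') _)) 2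
  have bG : ∀ H' ∈ p.support, ∀ H'' ∈ (P.step (t₀ + s) H').support,
      |(H''.numDegree k : ℝ)| ≤ CO + 1 := fun H' h' H'' h'' => by
    have h1 := order_le_of_isNext (isNext_of_mem_step h'')
    have h2 := bO H' h'
    rw [Nat.abs_cast] at h2 ⊢
    have h3 : (H''.numDegree k : ℝ) ≤ H''.order := by exact_mod_cast H''.numDegree_le k
    linarith
  have hvar : (mean p fun H' => ((H'.weight P.γ : ℝ) - w * s) ^ 2) ≤ P.weightVar c H s := by
    have := mean_run_sq_le hc (isAdditive_weight P.γ) P.γ.coe_nonneg zero_le_one hY hX H s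
    rw [one_mul, one_mul] at this
    exact this
  -- the recursion for a fixed hypergraph
  have hpt : ∀ H' ∈ p.support,
      |mean (P.step (t₀ + s) H') (fun H'' => (H''.numDegree k : ℝ)) -
        (((H'.numDegree k : ℝ) + P.source k) + P.rate μ₀ μ / s *
          (H'.prevWeight P.γ k - (k + P.γ) * H'.numDegree k))| ≤
      l / (w * s) * |(H'.weight P.γ : ℝ) - w * s| +
        (2 * (P.m * c s) * (2 * (P.m * c s * (k + P.γ)) / (w * s)) +
          2 * (P.m * c s) * 4 / (w * s) ^ 2 * ((H'.weight P.γ : ℝ) - w * s) ^ 2) :=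
    fun H' h' => by
      have hW : 0 < H'.weight P.γ := hH.trans_le (weight_le_of_mem_run hc h')
      have hWr : (0 : ℝ) < H'.weight P.γ := by exact_mod_cast hW
      have h1 := abs_mean_step_numDegree_sub_le hY hX hW.ne' hc0 (hc.Y_le s) (hc.X_le s) k
      have a1 := prevWeight_nonneg H' P.γ k
      have a2 := prevWeight_le H' P.γ k
      have a3 := H'.mul_numDegree_le_weight P.γ k
      have a4 : 0 ≤ (k + P.γ) * (H'.numDegree k : ℝ) := by positivity
      rw [← hl] at h1
      generalize mean (P.step (t₀ + s) H') (fun H'' => (H''.numDegree k : ℝ)) = G at *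
      set W : ℝ := (H'.weight P.γ : ℝ) with hWd
      set d := H'.prevWeight P.γ k - (k + P.γ) * H'.numDegree k with hd
      -- Inflow and outflow both lie in `[0, W]`. Hence `|d / W| ≤ 1`, and the error of the new
      -- denominator is linear in `|W - w s|`, with no inverse moments of `W`.
      have hdW : |d| ≤ W := abs_le.2 ⟨by linarith, by linarith⟩
      have h2 : |l * (d / W) - P.rate μ₀ μ / s * d| ≤ l / (w * s) * |W - w * s| := by
        have e : l * (d / W) - P.rate μ₀ μ / s * d = l / (w * s) * (d / W) * (-(W - w * s)) := by
          rw [rate, ← hl, ← hwdef]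
          field_simp
          ring
        have h3 : |d / W| ≤ 1 := by
          rw [abs_div, abs_of_pos hWr]
          exact (div_le_one hWr).2 hdW
        rw [e, abs_mul, abs_neg, abs_mul, abs_of_nonneg (by positivity : 0 ≤ l / (w * s))]
        have h4 : 0 ≤ l / (w * s) := by positivity
        exact mul_le_mul_of_nonneg_right (mul_le_of_le_one_right h4 h3) (abs_nonneg _)
      have h5 : 2 * (P.m * c s) * min 1 (P.m * c s * ((k + P.γ) / W)) ≤
          2 * (P.m * c s) * (2 * (P.m * c s * (k + P.γ)) / (w * s)) +
          2 * (P.m * c s) * 4 / (w * s) ^ 2 * (W - w * s) ^ 2 := by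
        have h6 := min_one_le (W := W) (x := P.m * c s * (k + P.γ)) (by positivity) hws
        rw [mul_div_assoc] at h6
        refine (mul_le_mul_of_nonneg_left h6 (by positivity)).trans_eq ?_
        ring
      have h7 := abs_add_le (G - (H'.numDegree k + P.source k + l * (d / W)))
        (l * (d / W) - P.rate μ₀ μ / s * d)
      rw [show G - (H'.numDegree k + P.source k + l * (d / W)) +
        (l * (d / W) - P.rate μ₀ μ / s * d) =
        G - (H'.numDegree k + P.source k + P.rate μ₀ μ / s * d) by ring] at h7
      linarith
  have iG : HasExp p fun H' => mean (P.step (t₀ + s) H') (fun H'' => (H''.numDegree k : ℝ)) :=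
    HasExp.of_bdd fun H' h' => abs_mean_le_of_abs_le (bG H' h')
  have i1 : HasExp p fun H' => (H'.numDegree k : ℝ) + P.source k := iN.add (HasExp.const _ _)
  have i2 : HasExp p fun H' => H'.prevWeight P.γ k - (k + P.γ) * H'.numDegree k :=
    iA.sub (iN.const_mul _)
  have i3 : HasExp p fun H' => (2 * (P.m * c s) * (2 * (P.m * c s * (k + P.γ)) / (w * s)) +
          2 * (P.m * c s) * 4 / (w * s) ^ 2 * ((H'.weight P.γ : ℝ) - w * s) ^ 2) :=
    (HasExp.const _ _).add (iS.const_mul _)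
  have hmain := abs_mean_sub_mean_le iG (i1.add (i2.const_mul (P.rate μ₀ μ / s)))
    ((iD.abs.const_mul (l / (w * s))).add i3) hpt
  rw [mean_add i1 (i2.const_mul _), mean_add iN (HasExp.const _ _), mean_const, mean_const_mul,
    mean_sub iA (iN.const_mul _), mean_const_mul, mean_add (iD.abs.const_mul _) i3,
    mean_const_mul, mean_add (HasExp.const _ _) (iS.const_mul _), mean_const, mean_const_mul,
    ← mean_bind_of_bdd bG] at hmain
  have habs : (mean p fun H' => |(H'.weight P.γ : ℝ) - w * s|) ≤ √(P.weightVar c H s) :=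
    (mean_abs_sq_le iD iS).trans (Real.sqrt_le_sqrt hvar)
  have b1 : l / (w * s) * (mean p fun H' => |(H'.weight P.γ : ℝ) - w * s|) ≤
      l / (w * s) * √(P.weightVar c H s) := mul_le_mul_of_nonneg_left habs (by positivity)
  have b2 : 2 * (P.m * c s) * 4 / (w * s) ^ 2 *
      (mean p fun H' => ((H'.weight P.γ : ℝ) - w * s) ^ 2) ≤
      2 * (P.m * c s) * 4 / (w * s) ^ 2 * P.weightVar c H s :=
    mul_le_mul_of_nonneg_left hvar (by positivity)
  rw [recursionError, run, ← hl, ← hwdef]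
  have e : l * (√(P.weightVar c H s) / (w * s)) +
      2 * (P.m * c s) * (2 * (P.m * c s * (k + P.γ)) / (w * s) +
      4 * (P.weightVar c H s / (w * s) ^ 2)) =
      l / (w * s) * √(P.weightVar c H s) +
      (2 * (P.m * c s) * (2 * (P.m * c s * (k + P.γ)) / (w * s)) +
          2 * (P.m * c s) * 4 / (w * s) ^ 2 * P.weightVar c H s) := by ring
  rw [e]
  refine le_trans (le_of_eq ?_) (hmain.trans (add_le_add b1 (add_le_add le_rfl b2)))
  congr 2
  ring

/-- The limit of the expected number of vertices of degree `k`, divided by the time. -/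
noncomputable def degreeRate (P : Model r) (μ₀ : ℝ) (μ : Fin r → ℝ) : ℕ → ℝ
  | 0 => P.source 0 / (1 + P.rate μ₀ μ * P.γ)
  | k + 1 => (P.source (k + 1) + P.rate μ₀ μ * ((k + P.γ) * degreeRate P μ₀ μ k)) /
      (1 + P.rate μ₀ μ * ((k + 1 : ℕ) + P.γ))

/-- Induction on `k`: the inflow into degree `k + 1` is `k + γ` times the count at degree `k`, and
degree `0` has none. Each stage is a scalar recursion with `b = ρ (k + γ)`. -/
theorem tendsto_mean_run_numDegree_div (hc : P.GrowthBound t₀ c)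
    (hY : ∀ t, HasMean (P.Y t) μ₀) (hX : ∀ i t, HasMean (P.X i t) (μ i))
    (hD : 0 ≤ P.Dbar μ₀ μ - P.m * P.pve) (hw : 0 < P.weightRate μ₀ μ)
    {H : MultiHypergraph} (hH : 0 < H.weight P.γ) (k : ℕ) :
    Tendsto (fun s : ℕ => mean (P.run t₀ H s) (fun H' => (H'.numDegree k : ℝ)) / s) atTop
      (𝓝 (P.degreeRate μ₀ μ k)) := by
  have hrate : 0 ≤ P.rate μ₀ μ := div_nonneg hD hw.le
  have key : ∀ k q, Tendsto (fun s : ℕ => mean (P.run t₀ H s) (fun H' => H'.prevWeight P.γ k) / s)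
      atTop (𝓝 q) →
      Tendsto (fun s : ℕ => mean (P.run t₀ H s) (fun H' => (H'.numDegree k : ℝ)) / s) atTop
      (𝓝 ((P.source k + P.rate μ₀ μ * q) / (1 + P.rate μ₀ μ * (k + P.γ)))) := fun k q hq => by
    refine tendsto_div_of_recursion (by positivity) ?_
    have herr : Tendsto (fun s : ℕ => mean (P.run t₀ H (s + 1)) (fun H' => (H'.numDegree k : ℝ)) -
      (mean (P.run t₀ H s) (fun H' => (H'.numDegree k : ℝ)) + P.source k + P.rate μ₀ μ *
        ((mean (P.run t₀ H s) (fun H' => H'.prevWeight P.γ k) -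
          (k + P.γ) * mean (P.run t₀ H s) (fun H' => (H'.numDegree k : ℝ))) / s))) atTop (𝓝 0) := by
      refine squeeze_zero_norm' ?_ (tendsto_recursionError (μ₀ := μ₀) (μ := μ) hc H k)
      filter_upwards [eventually_ne_atTop 0] with s hs
      exact abs_mean_run_succ_numDegree_sub_le hc hY hX hD hw hH k hs
    have hsum := herr.add ((hq.const_mul (P.rate μ₀ μ)).const_add (P.source k))
    rw [zero_add] at hsum
    refine hsum.congr fun s => ?_
    ring
  induction k with
  | zero =>
    have h := key 0 0 (by simp only [prevWeight_zero, mean_const, zero_div]; exact tendsto_const_nhds)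
    simpa [degreeRate] using h
  | succ k ih =>
    have h := key (k + 1) ((k + P.γ) * P.degreeRate μ₀ μ k) (by
      simp only [prevWeight_succ, mean_const_mul, mul_div_assoc]
      exact ih.const_mul _)
    rw [degreeRate]
    exact h

/-! ### From rates per unit of time to fractions of the vertices -/

theorem abs_numDegree_div_order_le (H : MultiHypergraph) (k : ℕ) :
    |(H.numDegree k : ℝ) / H.order| ≤ 1 := by
  rw [abs_of_nonneg (by positivity)]
  exact div_le_one_of_le₀ (by exact_mod_cast H.numDegree_le k) (Nat.cast_nonneg _)

/-- `N / |V| - N / (V̄ s)` is `(V̄ s - |V|) / (V̄ s)` times a fraction at most `1`. The order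
changes by at most `1` per step, so its mean deviation is `O(√s)`. -/
theorem tendsto_mean_run_numDegree_div_order (hc : P.GrowthBound t₀ c)
    (hY : ∀ t, HasMean (P.Y t) μ₀) (hX : ∀ i t, HasMean (P.X i t) (μ i))
    (hD : 0 ≤ P.Dbar μ₀ μ - P.m * P.pve) (hw : 0 < P.weightRate μ₀ μ) (hV : 0 < P.Vbar)
    {H : MultiHypergraph} (hH : 0 < H.weight P.γ) (k : ℕ) :
    Tendsto (fun s : ℕ => mean (P.run t₀ H s) (fun H' => (H'.numDegree k : ℝ) / H'.order)) atTop
      (𝓝 (P.degreeRate μ₀ μ k / P.Vbar)) := by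
  have hmain := (tendsto_mean_run_numDegree_div hc hY hX hD hw hH k).div_const P.Vbar
  have hdiff : Tendsto (fun s : ℕ =>
      mean (P.run t₀ H s) (fun H' => (H'.numDegree k : ℝ) / H'.order) -
      mean (P.run t₀ H s) (fun H' => (H'.numDegree k : ℝ)) / s / P.Vbar) atTop (𝓝 0) := by
    have hlim : Tendsto (fun s : ℕ => √((H.order : ℝ) ^ 2 + s) / s / P.Vbar) atTop (𝓝 0) := by
      have h1 : Tendsto (fun s : ℕ => (1 : ℝ) / s) atTop (𝓝 0) :=
        tendsto_one_div_atTop_nhds_zero_nat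
      have h2 := (((h1.mul h1).const_mul ((H.order : ℝ) ^ 2)).add h1).sqrt.div_const P.Vbar
      simp only [mul_zero, add_zero, Real.sqrt_zero, zero_div] at h2
      refine h2.congr' ?_
      filter_upwards [eventually_ne_atTop 0] with s hs
      have hs0 : (s : ℝ) ≠ 0 := by positivity
      rw [show (H.order : ℝ) ^ 2 * (1 / s * (1 / s)) + 1 / s = ((H.order : ℝ) ^ 2 + s) / s ^ 2 by
        field_simp, Real.sqrt_div' _ (by positivity), Real.sqrt_sq (Nat.cast_nonneg s)]
    refine squeeze_zero_norm' ?_ hlim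
    filter_upwards [eventually_ne_atTop 0] with s hs
    have hs0 : (0 : ℝ) < s := by positivity
    have bO := abs_le_of_mem_run hc isAdditive_order zero_le_one le_rfl H s
    have iO : HasExp (P.run t₀ H s) fun H' => (H'.order : ℝ) - P.Vbar * s :=
      (HasExp.of_bdd bO).sub (HasExp.const _ _)
    have iS : HasExp (P.run t₀ H s) fun H' => ((H'.order : ℝ) - P.Vbar * s) ^ 2 :=
      HasExp.of_bdd fun H' h' => by
        rw [abs_pow]
        exact pow_le_pow_left₀ (abs_nonneg _) ((abs_sub _ _).trans
          (add_le_add_left (bO H' h') _)) 2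
    have iN : HasExp (P.run t₀ H s) fun H' => (H'.numDegree k : ℝ) :=
      HasExp.of_bdd fun H' h' => by
        refine le_trans ?_ (bO H' h')
        simp only [Nat.abs_cast]
        exact_mod_cast H'.numDegree_le k
    have h1 := abs_mean_sub_mean_le (p := P.run t₀ H s)
      (HasExp.of_bdd fun H' _ => abs_numDegree_div_order_le H' k)
      (iN.const_mul (1 / (P.Vbar * s))) (iO.abs.const_mul (1 / (P.Vbar * s))) fun H' _ => by
        have ho : (0 : ℝ) < H'.order := by exact_mod_cast H'.order_pos
        have e : (H'.numDegree k : ℝ) / H'.order - 1 / (P.Vbar * s) * H'.numDegree k =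
            1 / (P.Vbar * s) * (-((H'.order : ℝ) - P.Vbar * s)) *
              ((H'.numDegree k : ℝ) / H'.order) := by
          field_simp
          ring
        rw [e, abs_mul, abs_mul, abs_neg, abs_of_pos (by positivity : 0 < 1 / (P.Vbar * s))]
        exact mul_le_of_le_one_right (by positivity) (abs_numDegree_div_order_le H' k)
    rw [mean_const_mul, mean_const_mul] at h1
    have hvar := mean_run_sq_le hc isAdditive_order zero_le_one le_rfl hY hX H s
    simp only [one_mul, zero_mul, add_zero, one_pow, mul_one] at hvar
    have h2 := (mean_abs_sq_le iO iS).trans (Real.sqrt_le_sqrt hvar)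
    have e : ∀ x : ℝ, x / s / P.Vbar = 1 / (P.Vbar * s) * x := fun x => by field_simp
    rw [Real.norm_eq_abs, e, e]
    exact h1.trans (mul_le_mul_of_nonneg_left h2 (by positivity))
  have := hdiff.add hmain
  simpa using this

end Model

end PrefAttach

/-! ### Integrals against a `PMF` -/

namespace PrefAttach

open MeasureTheory in
theorem toMeasure_eq_sum {α : Type*} [MeasurableSpace α] (p : PMF α) :
    p.toMeasure = Measure.sum fun x : p.support => p x • Measure.dirac (x : α) := by
  ext s hs
  rw [p.toMeasure_apply hs, Measure.sum_apply _ hs,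
    ← tsum_subtype_eq_of_support_subset (s := p.support)]
  · refine tsum_congr fun x => ?_
    rw [Measure.smul_apply, Measure.dirac_apply' _ hs, smul_eq_mul]
    by_cases hx : (x : α) ∈ s <;> simp [hx]
  · intro x hx hx0
    exact hx (Set.indicator_apply_eq_zero.2 fun _ => hx0)

/-- Expectations as integrals. -/
theorem integral_toMeasure {α : Type*} [MeasurableSpace α] [MeasurableSingletonClass α]
    {p : PMF α} {f : α → ℝ} (hf : HasExp p f) : ∫ x, f x ∂p.toMeasure = mean p f := by
  have : Countable p.support := p.support_countable.to_subtype
  rw [toMeasure_eq_sum, MeasureTheory.integral_sum_dirac_eq_tsum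
    (fun x => p.apply_ne_top _) ?_]
  · simp only [smul_eq_mul]
    exact tsum_subtype_eq_of_support_subset (f := fun x => (p x).toReal * f x) fun x hx =>
      by_contra fun h => hx (by simp [toReal_eq_zero_of_notMem h])
  · have := (Summable.norm hf).subtype p.support
    refine this.congr fun x => ?_
    simp [Function.comp_apply, norm_mul]

/-! ### Asymptotics of products of linear factors -/

/-- Euler's `GammaSeq a n` is `n^a n!` over the product of the `a + j`; the factorials cancel in the
quotient. -/
theorem prod_div_prod_eq {a b : ℝ} (ha : 0 < a) (hb : 0 < b) {n : ℕ} (hn : n ≠ 0) :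
    ∏ j ∈ Finset.range (n + 1), (a + j) / (b + j) =
      (n : ℝ) ^ (a - b) * (Real.GammaSeq b n / Real.GammaSeq a n) := by
  have hn0 : (0 : ℝ) < n := by positivity
  have h1 : ∏ j ∈ Finset.range (n + 1), (a + j) ≠ 0 :=
    Finset.prod_ne_zero_iff.2 fun j _ => by positivity
  have h2 : ∏ j ∈ Finset.range (n + 1), (b + j) ≠ 0 :=
    Finset.prod_ne_zero_iff.2 fun j _ => by positivity
  have h3 : (n : ℝ) ^ a ≠ 0 := (Real.rpow_pos_of_pos hn0 a).ne'
  have h4 : (n : ℝ) ^ b ≠ 0 := (Real.rpow_pos_of_pos hn0 b).ne'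
  have h5 : (n.factorial : ℝ) ≠ 0 := by positivity
  rw [Finset.prod_div_distrib, Real.GammaSeq, Real.GammaSeq, Real.rpow_sub hn0]
  field_simp

/-- A sequence with `L (k + 1) / L k = (a + (k - k₀)) / (b + (k - k₀))` for `k ≥ k₀` is
asymptotic to a multiple of `k ^ (a - b)`. -/
theorem exists_tendsto_div_rpow {L : ℕ → ℝ} {k₀ : ℕ} {a b : ℝ} (ha : 0 < a) (hb : 0 < b)
    (h0 : 0 < L k₀) (h : ∀ n : ℕ, L (k₀ + (n + 1)) = L (k₀ + n) * ((a + n) / (b + n))) :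
    ∃ c : ℝ, 0 < c ∧ Tendsto (fun k : ℕ => L k / (c * (k : ℝ) ^ (a - b))) atTop (𝓝 1) := by
  have hL : ∀ n : ℕ, L (k₀ + n) = L k₀ * ∏ j ∈ Finset.range n, (a + j) / (b + j) := fun n => by
    induction n with
    | zero => simp
    | succ n ih => rw [h, ih, Finset.prod_range_succ, mul_assoc]
  have hGa := Real.Gamma_pos_of_pos ha
  have hGb := Real.Gamma_pos_of_pos hb
  refine ⟨L k₀ * (Real.Gamma b / Real.Gamma a), by positivity, ?_⟩
  rw [← tendsto_add_atTop_iff_nat (k₀ + 1)]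
  have h1 := (Real.GammaSeq_tendsto_Gamma b).div (Real.GammaSeq_tendsto_Gamma a) hGa.ne'
  -- Corrects for the power being taken at `k = k₀ + n + 1` and not at `n`.
  have h2 : Tendsto (fun n : ℕ => ((n : ℝ) / (n + (k₀ + 1 : ℕ))) ^ (a - b)) atTop (𝓝 1) := by
    have h3 := (tendsto_natCast_div_add_atTop (𝕜 := ℝ) ((k₀ + 1 : ℕ) : ℝ)).rpow_const
      (p := a - b) (Or.inl one_ne_zero)
    rwa [Real.one_rpow] at h3
  have h4 := (h1.div_const (Real.Gamma b / Real.Gamma a)).mul h2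
  rw [div_self (by positivity), one_mul] at h4
  refine h4.congr' ?_
  filter_upwards [eventually_ne_atTop 0] with n hn
  have hn0 : (0 : ℝ) < n := by positivity
  rw [show n + (k₀ + 1) = k₀ + (n + 1) by ring, hL, prod_div_prod_eq ha hb hn,
    Real.div_rpow hn0.le (by positivity)]
  have h5 : ((n : ℝ) + (k₀ + 1 : ℕ)) = ((k₀ + (n + 1) : ℕ) : ℝ) := by push_cast; ring
  have h6 : (((k₀ + (n + 1) : ℕ) : ℝ)) ^ (a - b) ≠ 0 :=
    (Real.rpow_pos_of_pos (by positivity) _).ne'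
  rw [h5, Pi.div_apply]
  field_simp

namespace Model

open MultiHypergraph

variable {r : ℕ} {P : Model r} {μ₀ : ℝ} {μ : Fin r → ℝ}

/-! ### Limits for the original process -/

theorem expect_eq_mean {t : ℕ} {f : MultiHypergraph → ℝ} (hf : HasExp (P.law t) f) :
    P.expect t f = mean (P.law t) f := by
  have : MeasurableSingletonClass MultiHypergraph := ⟨fun _ => trivial⟩
  exact integral_toMeasure hf

theorem weight_le_of_isNext {t : ℕ} {H H' : MultiHypergraph} (γ : ℝ≥0) (h : P.IsNext t H H') :
    H.weight γ ≤ H'.weight γ := by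
  have hf := isAdditive_weight γ
  have hr : (H.weight γ : ℝ) ≤ H'.weight γ := by
    cases h with
    | vertex => rw [hf.addVertex]; simp
    | vertexEdges y hy es hes hsum =>
      rw [hf.addVertex, add_assoc]; exact le_add_of_nonneg_right (by positivity)
    | edges i x hx es hsum => rw [hf.addEdges]; exact le_add_of_nonneg_right (by positivity)
    | nothing => exact le_rfl
  exact_mod_cast hr

/-- The uniform fallback in `chooseVertex` is never used on a reachable hypergraph, because the
weight cannot decrease. -/
theorem weight_pos_of_mem_law {t : ℕ} {H : MultiHypergraph} (h : H ∈ (P.law t).support) :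
    0 < H.weight P.γ := by
  induction t generalizing H with
  | zero =>
    rw [law, PMF.support_pure, Set.mem_singleton_iff] at h
    exact h ▸ P.weight_pos
  | succ t ih =>
    rw [law, PMF.mem_support_bind_iff] at h
    obtain ⟨H₁, h₁, h⟩ := h
    exact (ih h₁).trans_le (weight_le_of_isNext _ (isNext_of_mem_step h))

/-- For `s ≥ 1`, `t₀ + s ≤ (t₀ + 1) s`, so the cube of the bound is `O(s^(3/4))`. -/
theorem growthBound_rpow {t₀ : ℕ} (ht₀ : 1 ≤ t₀)
    (hY : ∀ t ≥ t₀, ∀ y ∈ (P.Y t).support, (y : ℝ) < (t : ℝ) ^ (1 / 4 : ℝ))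
    (hX : ∀ t ≥ t₀, ∀ i, ∀ x ∈ (P.X i t).support, (x : ℝ) < (t : ℝ) ^ (1 / 4 : ℝ)) :
    P.GrowthBound t₀ fun s => ((t₀ + s : ℕ) : ℝ) ^ (1 / 4 : ℝ) where
  one_le s := Real.one_le_rpow (by exact_mod_cast ht₀.trans (Nat.le_add_right _ _)) (by norm_num)
  mono s s' h := Real.rpow_le_rpow (by positivity) (by exact_mod_cast Nat.add_le_add_left h t₀)
    (by norm_num)
  Y_le s y hy := (hY _ (Nat.le_add_right _ _) y hy).le
  X_le s i x hx := (hX _ (Nat.le_add_right _ _) i x hx).le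
  tendsto := by
    have h1 : Tendsto (fun s : ℕ => (s : ℝ) ^ (-(1 / 4) : ℝ)) atTop (𝓝 0) :=
      (tendsto_rpow_neg_atTop (by norm_num)).comp tendsto_natCast_atTop_atTop
    have h2 := h1.const_mul (((t₀ + 1 : ℕ) : ℝ) ^ (3 / 4 : ℝ))
    rw [mul_zero] at h2
    refine squeeze_zero' (Eventually.of_forall fun s => by positivity) ?_ h2
    filter_upwards [eventually_ge_atTop 1] with s hs
    have hs0 : (0 : ℝ) < s := by positivity
    have h3 : ((t₀ + s : ℕ) : ℝ) ≤ ((t₀ + 1 : ℕ) : ℝ) * s := by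
      have : t₀ + s ≤ (t₀ + 1) * s := by nlinarith
      exact_mod_cast this
    rw [← Real.rpow_natCast, ← Real.rpow_mul (by positivity), div_le_iff₀ hs0]
    calc ((t₀ + s : ℕ) : ℝ) ^ ((1 / 4 : ℝ) * (3 : ℕ))
        = ((t₀ + s : ℕ) : ℝ) ^ (3 / 4 : ℝ) := by norm_num
      _ ≤ (((t₀ + 1 : ℕ) : ℝ) * s) ^ (3 / 4 : ℝ) := by gcongr
      _ = ((t₀ + 1 : ℕ) : ℝ) ^ (3 / 4 : ℝ) * (s : ℝ) ^ (3 / 4 : ℝ) :=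
        Real.mul_rpow (by positivity) hs0.le
      _ = ((t₀ + 1 : ℕ) : ℝ) ^ (3 / 4 : ℝ) * ((s : ℝ) ^ (-(1 / 4) : ℝ) * s) := by
        rw [← Real.rpow_add_one hs0.ne']
        norm_num
      _ = _ := (mul_assoc _ _ _).symm

/-- The limits of the expected fractions of vertices of degree `k`. -/
theorem tendsto_expect_numDegree_div_order
    (hY : ∀ t, HasMean (P.Y t) μ₀) (hX : ∀ i t, HasMean (P.X i t) (μ i))
    (hYlt : ∀ᶠ t : ℕ in atTop, ∀ y ∈ (P.Y t).support, (y : ℝ) < (t : ℝ) ^ (1 / 4 : ℝ))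
    (hXlt : ∀ i, ∀ᶠ t : ℕ in atTop, ∀ x ∈ (P.X i t).support, (x : ℝ) < (t : ℝ) ^ (1 / 4 : ℝ))
    (hD : 0 ≤ P.Dbar μ₀ μ - P.m * P.pve) (hw : 0 < P.weightRate μ₀ μ) (hV : 0 < P.Vbar) (k : ℕ) :
    Tendsto (fun t => P.expect t fun H => (H.numDegree k : ℝ) / H.order) atTop
      (𝓝 (P.degreeRate μ₀ μ k / P.Vbar)) := by
  obtain ⟨t₀, ht₀⟩ := eventually_atTop.1
    ((hYlt.and (eventually_all.2 hXlt)).and (eventually_ge_atTop 1))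
  have hc := growthBound_rpow (P := P) (ht₀ t₀ le_rfl).2 (fun t ht => (ht₀ t ht).1.1)
    fun t ht => (ht₀ t ht).1.2
  rw [← tendsto_add_atTop_iff_nat t₀]
  -- Every reachable `H_{t₀}` gives the same limit, and fractions are bounded by `1`.
  have h := tendsto_mean (p := P.law t₀)
    (F := fun s H => mean (P.run t₀ H s) fun H' => (H'.numDegree k : ℝ) / H'.order)
    (fun s H _ => abs_mean_le_of_abs_le fun H' _ => abs_numDegree_div_order_le H' k)
    fun H hH => tendsto_mean_run_numDegree_div_order hc hY hX hD hw hV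
      (weight_pos_of_mem_law hH) k
  refine h.congr fun s => ?_
  rw [expect_eq_mean (HasExp.of_bdd fun H' _ => abs_numDegree_div_order_le H' k), add_comm s,
    law_add, mean_bind_of_bdd fun _ _ H' _ => abs_numDegree_div_order_le H' k]

/-- The expected sum of the degrees grows linearly. -/
theorem hasExp_law_totalDegree
    (hY : ∀ t, HasMean (P.Y t) μ₀) (hX : ∀ i t, HasMean (P.X i t) (μ i)) (t : ℕ) :
    HasExp (P.law t) (fun H => (H.totalDegree : ℝ)) ∧
      mean (P.law t) (fun H => (H.totalDegree : ℝ)) =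
        P.H₀.totalDegree + t * P.Dbar μ₀ μ := by
  induction t with
  | zero => exact ⟨HasExp.pure _ _, by simp [law, mean_pure]⟩
  | succ t ih =>
    have hstep := fun H => hasExp_step_of_isAdditive isAdditive_totalDegree hY hX t H
    have hdrift : HasExp (P.law t) fun H =>
        (H.totalDegree : ℝ) + (0 * P.Vbar + 1 * P.Dbar μ₀ μ) := ih.1.add (HasExp.const _ _)
    obtain ⟨h1, h2⟩ := hasExp_bind_and_mean_bind (p := P.law t) (q := P.step t)
      (f := fun H => (H.totalDegree : ℝ)) (fun H _ => (hstep H).1)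
      (by simpa only [Nat.abs_cast, (hstep _).2] using hdrift)
    refine ⟨h1, h2.trans ?_⟩
    simp only [(hstep _).2]
    rw [mean_add ih.1 (HasExp.const _ _), mean_const, ih.2]
    push_cast
    ring

theorem tendsto_expect_totalDegree_div
    (hY : ∀ t, HasMean (P.Y t) μ₀) (hX : ∀ i t, HasMean (P.X i t) (μ i)) :
    Tendsto (fun t : ℕ => P.expect (t - 1) (fun H => (H.totalDegree : ℝ)) / t) atTop
      (𝓝 (P.Dbar μ₀ μ)) := by
  have h1 := (tendsto_const_div_atTop_nhds_zero_nat
    ((P.H₀.totalDegree : ℝ) - P.Dbar μ₀ μ)).add_const (P.Dbar μ₀ μ)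
  rw [zero_add] at h1
  refine h1.congr' ?_
  filter_upwards [eventually_ge_atTop 1] with t ht
  have h := hasExp_law_totalDegree (P := P) hY hX (t - 1)
  have ht0 : (t : ℝ) ≠ 0 := by positivity
  rw [expect_eq_mean h.1, h.2]
  push_cast [ht]
  field_simp
  ring

/-! ### Signs, the tail of the limit sequence, and the exponent -/

theorem one_le_of_hasMean {p : PMF ℕ} {x : ℝ} (h : HasMean p x) (hp : ∀ n ∈ p.support, 1 ≤ n) :
    1 ≤ x := by
  rw [← mean_const p 1, ← h.mean_eq]
  exact mean_mono (HasExp.const _ _) h.hasExp fun n hn => by exact_mod_cast hp n hn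

/-- This is `m (p_ve (μ₀ - 1) + ∑ p_e μ_i)`, the mean number of draws per step, and cardinalities
are at least `1`. -/
theorem Dbar_sub_nonneg
    (hY : ∀ t, HasMean (P.Y t) μ₀) (hX : ∀ i t, HasMean (P.X i t) (μ i)) :
    0 ≤ P.Dbar μ₀ μ - P.m * P.pve := by
  have h1 := one_le_of_hasMean (hY 0) (P.Y_pos 0)
  have h2 : 0 ≤ ∑ i, P.pe i * μ i := Finset.sum_nonneg fun i _ => mul_nonneg (P.pe i).coe_nonneg
    (zero_le_one.trans (one_le_of_hasMean (hX i 0) (P.X_pos i 0)))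
  have h3 : 0 ≤ (P.pve : ℝ) * (μ₀ - 1) := mul_nonneg P.pve.coe_nonneg (by linarith)
  rw [Dbar, ← mul_sub]
  exact mul_nonneg (Nat.cast_nonneg _) (by linarith)

theorem source_nonneg (k : ℕ) : 0 ≤ P.source k := by
  rw [source]
  split_ifs <;> positivity

theorem degreeRate_nonneg (hρ : 0 ≤ P.rate μ₀ μ) (k : ℕ) : 0 ≤ P.degreeRate μ₀ μ k := by
  induction k with
  | zero => exact div_nonneg (source_nonneg 0) (by positivity)
  | succ k ih =>
    have := source_nonneg (P := P) (k + 1)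
    rw [degreeRate]
    positivity

/-- The seed of the tail product. If `p_ve ≠ 0`, new vertices enter at degree `m`. Otherwise `γ p_v
> 0`: isolated vertices appear at a positive rate and can be chosen, which makes every degree rate
positive. -/
theorem degreeRate_pos (hρ : 0 < P.rate μ₀ μ) (hm : P.m ≠ 0)
    (hV : P.γ * P.Vbar + P.m * P.pve ≠ 0) : 0 < P.degreeRate μ₀ μ P.m := by
  have hm0 : 0 < (P.m : ℝ) := by positivity
  by_cases hpve : P.pve = 0
  · have h1 : (P.γ : ℝ) * P.pv ≠ 0 := by simpa [Vbar, hpve] using hV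
    have hγ : 0 < (P.γ : ℝ) := lt_of_le_of_ne P.γ.coe_nonneg (left_ne_zero_of_mul h1).symm
    have hpv : 0 < (P.pv : ℝ) := lt_of_le_of_ne P.pv.coe_nonneg (right_ne_zero_of_mul h1).symm
    have : ∀ k, 0 < P.degreeRate μ₀ μ k := fun k => by
      induction k with
      | zero =>
        have hs : P.source 0 = P.pv := by simp [source, hm.symm]
        rw [degreeRate, hs]
        positivity
      | succ k ih =>
        have := source_nonneg (P := P) (k + 1)
        rw [degreeRate]
        positivity
    exact this _
  · have hp : 0 < (P.pve : ℝ) := by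
      have := pos_iff_ne_zero.2 hpve
      exact_mod_cast this
    obtain ⟨j, hj⟩ := Nat.exists_eq_succ_of_ne_zero hm
    have hs : P.source (j + 1) = P.pve := by simp [source, hj]
    have := degreeRate_nonneg hρ.le j
    rw [hj, Nat.succ_eq_add_one, degreeRate, hs]
    positivity

theorem degreeRate_add_succ (hρ : 0 < P.rate μ₀ μ) (n : ℕ) :
    P.degreeRate μ₀ μ (P.m + (n + 1)) = P.degreeRate μ₀ μ (P.m + n) *
      ((P.m + P.γ + n) / (P.m + 1 + P.γ + 1 / P.rate μ₀ μ + n)) := by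
  have hs : P.source (P.m + n + 1) = 0 := by
    rw [source, if_neg (by omega), if_neg (by omega), add_zero]
  rw [← add_assoc, degreeRate, hs]
  push_cast
  field_simp
  ring

/-- `w` is the sum of `γ V̄ + m p_ve` and `D̄ - m p_ve`, so `1 / ρ` is `1` plus their quotient. -/
theorem exponent_eq (hD : P.Dbar μ₀ μ - P.m * P.pve ≠ 0) :
    P.exponent μ₀ μ = 1 + 1 / P.rate μ₀ μ := by
  rw [exponent, rate, weightRate, one_div_div]
  field_simp
  ring

theorem followsPowerLaw_exponent
    (hY : ∀ t, HasMean (P.Y t) μ₀) (hX : ∀ i t, HasMean (P.X i t) (μ i))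
    (hYlt : ∀ᶠ t : ℕ in atTop, ∀ y ∈ (P.Y t).support, (y : ℝ) < (t : ℝ) ^ (1 / 4 : ℝ))
    (hXlt : ∀ i, ∀ᶠ t : ℕ in atTop, ∀ x ∈ (P.X i t).support, (x : ℝ) < (t : ℝ) ^ (1 / 4 : ℝ))
    (hD : P.Dbar μ₀ μ - P.m * P.pve ≠ 0) (hV : P.γ * P.Vbar + P.m * P.pve ≠ 0) :
    P.FollowsPowerLaw (P.exponent μ₀ μ) := by
  have hD0 : 0 < P.Dbar μ₀ μ - P.m * P.pve :=
    lt_of_le_of_ne (Dbar_sub_nonneg hY hX) hD.symm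
  have hm : P.m ≠ 0 := fun h => hD (by simp [Dbar, h])
  have hV0 : 0 < P.Vbar := by
    refine lt_of_le_of_ne (add_nonneg P.pv.coe_nonneg P.pve.coe_nonneg) fun h => hV ?_
    have h1 : (P.pve : ℝ) = 0 := by
      have h2 := P.pv.coe_nonneg
      have h3 := P.pve.coe_nonneg
      rw [Vbar] at h
      linarith
    rw [← h, h1, mul_zero, mul_zero, add_zero]
  have hw : 0 < P.weightRate μ₀ μ := by
    have h1 : 0 ≤ (P.m : ℝ) * P.pve := by positivity
    have h2 : 0 ≤ P.γ * P.Vbar := by positivity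
    rw [weightRate]
    linarith
  have hρ : 0 < P.rate μ₀ μ := div_pos hD0 hw
  have hm0 : 0 < (P.m : ℝ) := by positivity
  have hpos := degreeRate_pos hρ hm hV
  refine ⟨?_, fun k => P.degreeRate μ₀ μ k / P.Vbar, fun k =>
    tendsto_expect_numDegree_div_order hY hX hYlt hXlt hD0.le hw hV0 k, ?_⟩
  · rw [exponent_eq hD]
    exact le_add_of_nonneg_right (by positivity)
  · have h := exists_tendsto_div_rpow (L := fun k => P.degreeRate μ₀ μ k / P.Vbar) (k₀ := P.m)
      (a := P.m + P.γ) (b := P.m + 1 + P.γ + 1 / P.rate μ₀ μ) (by positivity) (by positivity)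
      (by positivity) fun n => by
        simp only [degreeRate_add_succ hρ n]
        ring
    rwa [show (P.m + P.γ : ℝ) - (P.m + 1 + P.γ + 1 / P.rate μ₀ μ) = -P.exponent μ₀ μ by
      rw [exponent_eq hD]; ring] at h

theorem Dbar_eq_of_forall_eq (hp : P.pve + ∑ i, P.pe i = 1) (hm : P.m = 1)
    (hμ : ∀ i, μ i = μ₀) : P.Dbar μ₀ μ = μ₀ := by
  have hp' : (P.pve : ℝ) + ∑ i, (P.pe i : ℝ) = 1 := by exact_mod_cast congrArg NNReal.toReal hp
  simp only [Dbar, hm, hμ, ← Finset.sum_mul]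
  rw [← add_mul, hp']
  simp

end Model

end PrefAttach

theorem theorem1 {r : ℕ} (P : PrefAttach.Model r) (μ₀ : ℝ) (μ : Fin r → ℝ)
    (hY : ∀ t, PrefAttach.HasMean (P.Y t) μ₀)
    (hX : ∀ i t, PrefAttach.HasMean (P.X i t) (μ i))
    (hYlt : ∀ᶠ t : ℕ in atTop, ∀ y ∈ (P.Y t).support, (y : ℝ) < (t : ℝ) ^ (1 / 4 : ℝ))
    (hXlt : ∀ i, ∀ᶠ t : ℕ in atTop, ∀ x ∈ (P.X i t).support, (x : ℝ) < (t : ℝ) ^ (1 / 4 : ℝ))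
    (hD : P.Dbar μ₀ μ - P.m * P.pve ≠ 0)
    (hV : P.γ * P.Vbar + P.m * P.pve ≠ 0) :
    P.FollowsPowerLaw (P.exponent μ₀ μ) ∧
    -- the exponent of the Barabási–Albert graph
    (P.pv = 0 → P.pve = 1 → P.γ = 0 → μ₀ = 2 → P.exponent μ₀ μ = 3) ∧
    -- the exponent of the Chung–Lu graph
    (P.pv = 0 → P.pve + ∑ i, P.pe i = 1 → P.m = 1 → P.γ = 0 → μ₀ = 2 → (∀ i, μ i = 2) →
      P.exponent μ₀ μ = 2 + (P.pve : ℝ) / (2 - P.pve)) ∧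
    -- the exponent `1 + D` of the hypergraph of Avin et al., `D = lim (E[D_{t-1}] / t) / (μ₀ - p_ve)`
    (P.pv = 0 → P.pve + ∑ i, P.pe i = 1 → P.m = 1 → P.γ = 0 → (∀ i, μ i = μ₀) →
      ∃ D : ℝ, Tendsto (fun t : ℕ =>
          P.expect (t - 1) (fun H => (H.totalDegree : ℝ)) / t / (μ₀ - P.pve)) atTop (𝓝 D) ∧
        P.exponent μ₀ μ = 1 + D) := by
  refine ⟨PrefAttach.Model.followsPowerLaw_exponent hY hX hYlt hXlt hD hV, ?_, ?_, ?_⟩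
  · intro hpv hpve hγ hμ₀
    have hpe : ∀ i, P.pe i = 0 := by
      have h1 := P.p_le_one
      rw [hpv, hpve, zero_add, add_le_iff_nonpos_right, nonpos_iff_eq_zero] at h1
      exact fun i => (Finset.sum_eq_zero_iff.1 h1) i (Finset.mem_univ i)
    have hDbar : P.Dbar μ₀ μ = P.m * 2 := by simp [PrefAttach.Model.Dbar, hpe, hpve, hμ₀]
    have hm : (P.m : ℝ) ≠ 0 := fun h => hD (by rw [hDbar, h]; ring)
    rw [PrefAttach.Model.exponent, hDbar, hγ, hpve, NNReal.coe_zero, NNReal.coe_one,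
      show (P.m : ℝ) * 2 - P.m * 1 = P.m by ring, zero_mul, zero_add, mul_one, div_self hm]
    norm_num
  · intro _ hp hm hγ hμ₀ hμ
    rw [PrefAttach.Model.exponent,
      PrefAttach.Model.Dbar_eq_of_forall_eq hp hm fun i => (hμ i).trans hμ₀.symm, hγ, hm, hμ₀]
    simp
  · intro _ hp hm hγ hμ
    have hDbar := PrefAttach.Model.Dbar_eq_of_forall_eq hp hm hμ
    have hlim := (PrefAttach.Model.tendsto_expect_totalDegree_div hY hX).div_const (μ₀ - P.pve)
    -- Here `D̄ = μ₀`, so `D = μ₀ / (μ₀ - p_ve)`, which is `1 + p_ve / (μ₀ - p_ve)`.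
    refine ⟨_, hlim, ?_⟩
    rw [hDbar, hm, Nat.cast_one, one_mul] at hD
    rw [PrefAttach.Model.exponent, hDbar, hγ, hm, NNReal.coe_zero, Nat.cast_one, one_mul, zero_mul,
      zero_add]
    field_simp
    ring
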